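/- **Setting.** A tensor $\mathcal C\in\mathbb R^{m\times n\times p}$ ($p\ge 1$) with frontal slices $\mathbf C^{(0)},\dots,\mathbf C^{(p-1)}$ has the block-circulant matrix $\mathrm{bcirc}(\mathcal C)$ whose $(a,b)$ block is $\mathbf C^{(a-b \bmod p)}$; $\mathrm{unfold}$ stacks the slices, $\mathrm{fold}$ is its inverse, and $\mathcal C\star\mathcal D=\mathrm{fold}(\mathrm{bcirc}(\mathcal C)\,\mathrm{unfold}(\mathcal D))$. The transpose is $\mathcal C^T=\mathrm{bcirc}^{-1}(\mathrm{bcirc}(\mathcal C)^T)$. A tensor $\mathcal C\in\mathbb R^{m\times m\times p}$ is symmetric if $\mathcal C^T=\mathcal C$; a symmetric $\mathcal C$ is T-positive semidefinite (TPSD), resp. T-positive definite (TPD), if $\langle\mathcal X,\mathcal C\star\mathcal X\rangle\ge 0$, resp. $>0$, for all nonzero $\mathcal X\in\mathbb R^{m\times1\times p}$, where $\langle\cdot,\cdot\rangle$ is the entrywise inner product. The T-eigenvalues of a symmetric $\mathcal C$ are the eigenvalues, with multiplicity, of the $p$ matrices $\sum_{a=0}^{p-1}e^{2\pi\iota ka/p}\,\mathbf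 C^{(a)}$, $0\le k<p$; $\vec\lambda(\mathcal C)=(\lambda_1(\mathcal C)\ge\dots\ge\lambda_{mp}(\mathcal C))$ lists them in decreasing order. For a real function $f$ and symmetric $\mathcal C$, $f(\mathcal C)$ is defined by $\mathrm{bcirc}(f(\mathcal C))=f(\mathrm{bcirc}(\mathcal C))$ (spectral calculus), and $|\mathcal H|=\sqrt{\mathcal H^T\star\mathcal H}$, $\|\mathcal H\|=\lambda_1(|\mathcal H|)$. A symmetric gauge function is a norm $\rho$ on $\mathbb R^{mp}$ that is invariant under permutations and sign changes of the coordinates; its unitarily invariant norm is $\|\mathcal H\|_\rho=\rho(\vec\lambda(|\mathcal H|))$. For $f:(0,\infty)\to[0,\infty)$ having a limit $f(0^+)\in[0,\infty]$ put $f(0)=f(0^+)$; for TPSD $\mathcal C$ set $\|f(\mathcal C)\|_\rho=\infty$ if $f(0^+)=\infty$ and $\mathcal C$ is not TPD. Conventions: $\log0=-\infty$, $\log\infty=\infty$, $e^{-\infty}=0$, $e^{\infty}=\infty$; integrals may take the values $\pm\infty$. For vectors $\mathbf x,\mathbf y$ of length $r$ with nonnegative entries in decreasing order, $\mathbf x\prec_{\log}\mathbf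 y$ means $\prod_{i\le k}x_i\le\prod_{i\le k}y_i$ for $1\le k\le r$, with equality for $k=r$. **Theorem.** Let $\Omega$ be a $\sigma$-compact metric space, $\nu$ a Borel probability measure on $\Omega$, $\mathcal C\in\mathbb R^{m\times m\times p}$ a TPSD tensor, and $\tau\mapsto\mathcal D_\tau\in\mathbb R^{m\times m\times p}$ a continuous map on $\Omega$ into the TPSD tensors with $\sup_\tau\|\mathcal D_\tau\|<\infty$. Suppose that $\int_\Omega\|\mathcal D_\tau^{-s}\|_{\rho_0}\,d\nu(\tau)<\infty$ for some $s>0$ and some symmetric gauge function $\rho_0$. Then the following three statements are equivalent. 1. $\vec\lambda(\mathcal C)\prec_{\log}\Bigl(\exp\int_\Omega\log\lambda_i(\mathcal D_\tau)\,d\nu(\tau)\Bigr)_{1\le i\le mp}$. 2. For every symmetric gauge function $\rho$ and every continuous $f:(0,\infty)\to[0,\infty)$ such that $x\mapsto\log f(e^x)$ is convex on $\mathbb R$, $$\|f(\mathcal C)\|_\rho\le\exp\int_\Omega\log\|f(\mathcal D_\tau)\|_\rho\,d\nu(\tau).$$ 3. For every symmetric gauge function $\rho$ and every continuous $g:(0,\infty)\to[0,\infty)$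 such that $x\mapsto g(e^x)$ is convex on $\mathbb R$, $$\|g(\mathcal C)\|_\rho\le\int_\Omega\|g(\mathcal D_\tau)\|_\rho\,d\nu(\tau).$$ -/

import Mathlib

open MeasureTheory Filter Topology Set
open scoped ENNReal

noncomputable section

/-- A real third-order tensor of size `m × n × p`; the entry `c_{ijk}` of `C` is `C i j k`.
The third index labels the frontal slices, counted from `0`. -/
abbrev TTensor (m n p : ℕ) : Type := Fin m → Fin n → Fin p → ℝ

namespace TTensor

variable {m n l p : ℕ}

/-- The block-circulant matrix of a tensor: its block `(a, b)` is the frontal slice number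
`a - b` (modulo `p`). -/
def bcirc (C : TTensor m n p) : Matrix (Fin p × Fin m) (Fin p × Fin n) ℝ :=
  Matrix.of fun x y => C x.2 y.2 (x.1 - y.1)

/-- The frontal slices stacked on top of each other. -/
def unfold (C : TTensor m n p) : Matrix (Fin p × Fin m) (Fin n) ℝ :=
  Matrix.of fun x j => C x.2 j x.1

/-- The inverse of `unfold`. -/
def fold (M : Matrix (Fin p × Fin m) (Fin n) ℝ) : TTensor m n p :=
  fun i j k => M (k, i) j

/-- The inverse of `bcirc`: read off the first block column. -/
def bcircInv [NeZero p] (M : Matrix (Fin p × Fin m) (Fin p × Fin n) ℝ) : TTensor m n p :=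
  fun i j k => M (k, i) (0, j)

theorem bcircInv_bcirc [NeZero p] (C : TTensor m n p) : bcircInv (bcirc C) = C := by
  funext i j k
  simp [bcircInv, bcirc]

/-- The T-product. -/
def tProduct (C : TTensor m n p) (D : TTensor n l p) : TTensor m l p :=
  fold (bcirc C * unfold D)

/-- The transpose of a T-product tensor. -/
def transpose [NeZero p] (C : TTensor m n p) : TTensor n m p :=
  bcircInv (bcirc C).transpose

/-- The entrywise inner product. -/
def inner (C D : TTensor m n p) : ℝ := ∑ i, ∑ j, ∑ k, C i j k * D i j k

/-- Symmetric T-product tensors. -/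
def IsSymmetric [NeZero p] (C : TTensor m m p) : Prop := C.transpose = C

/-- T-positive definite (TPD) tensors. -/
def IsTPD [NeZero p] (C : TTensor m m p) : Prop :=
  C.IsSymmetric ∧ ∀ X : TTensor m 1 p, X ≠ 0 → 0 < inner X (tProduct C X)

/-- T-positive semidefinite (TPSD) tensors. -/
def IsTPSD [NeZero p] (C : TTensor m m p) : Prop :=
  C.IsSymmetric ∧ ∀ X : TTensor m 1 p, X ≠ 0 → 0 ≤ inner X (tProduct C X)

/-- The `k`-th diagonal block `C_k = ∑ₐ ω ^ (k a) C⁽ᵃ⁾`, `ω = exp (2 π i / p)`, of `bcirc C` after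
the block diagonalization by the discrete Fourier transform,
`bcirc C = (Fᴴ ⊗ I) Diag (C_k) (F ⊗ I)` with `F = p ^ (-1/2) (ω ^ (k a))`. -/
def fourierBlock (C : TTensor m m p) (k : Fin p) : Matrix (Fin m) (Fin m) ℂ :=
  Matrix.of fun i j => ∑ a : Fin p,
    Complex.exp (2 * Real.pi * Complex.I * ((k : ℕ) : ℂ) * ((a : ℕ) : ℂ) / (p : ℂ)) * (C i j a : ℂ)

/-- The multiset of the `m * p` T-eigenvalues, with multiplicity: the eigenvalues of all the blocks
`C_k`. They are real when `C` is symmetric, the only case in which they are used. -/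
def tEigenvalueMultiset (C : TTensor m m p) : Multiset ℝ :=
  ∑ k : Fin p, (C.fourierBlock k).charpoly.roots.map Complex.re

/-- The vector `(λ₁(C), …, λ_{mp}(C))` of the T-eigenvalues in decreasing order. -/
def tEigenvalues (C : TTensor m m p) : Fin (m * p) → ℝ :=
  fun i => ((C.tEigenvalueMultiset.sort (fun a b : ℝ => a ≥ b)).getD (i : ℕ) 0)

/-- The tensor function `f(C)` of a symmetric tensor: `bcirc (f(C)) = f (bcirc C)`, where the right
side is the spectral function of a symmetric real matrix. -/
def tFun [NeZero p] (f : ℝ → ℝ) (C : TTensor m m p) : TTensor m m p :=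
  bcircInv (cfc f (bcirc C))

/-- The absolute value `|H| = √(Hᵀ ⋆ H)`. -/
def tAbs [NeZero p] (H : TTensor m m p) : TTensor m m p :=
  tFun Real.sqrt (tProduct H.transpose H)

/-- The operator norm `‖H‖ = λ₁(|H|)`. -/
def opNorm [NeZero p] (H : TTensor m m p) : ℝ := ⨆ i : Fin (m * p), H.tAbs.tEigenvalues i

/-- The norm `‖H‖_ρ = ρ(λ(|H|))` given by a symmetric gauge function `ρ`. -/
def gaugeNorm [NeZero p] (ρ : (Fin (m * p) → ℝ) → ℝ) (H : TTensor m m p) : ℝ :=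
  ρ H.tAbs.tEigenvalues

/-- A function on `(0, ∞)`, extended to `0` by its limit `f(0+)` (used only where that limit is
finite). -/
def extendAtZero (f : ℝ → ℝ) : ℝ → ℝ :=
  fun x => if 0 < x then f x else limUnder (𝓝[>] (0 : ℝ)) f

open Classical in
/-- `‖f(C)‖_ρ ∈ [0, ∞]` for a TPSD tensor `C` and a function `f : (0, ∞) → [0, ∞)` with a limit
`f(0+) ∈ [0, ∞]`, with the convention `f(0) = f(0+)`: the value is `∞` exactly when `f(0+) = ∞` and
`C` is not TPD. -/
def funNorm [NeZero p] (ρ : (Fin (m * p) → ℝ) → ℝ) (f : ℝ → ℝ) (C : TTensor m m p) : ℝ≥0∞ :=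
  if C.IsTPD ∨ ∃ c : ℝ, Tendsto f (𝓝[>] (0 : ℝ)) (𝓝 c) then
    ENNReal.ofReal (gaugeNorm ρ (tFun (extendAtZero f) C))
  else ∞

end TTensor

/-- Symmetric gauge functions on `ℝⁿ`: norms that are invariant under permutations and sign changes
of the coordinates. -/
structure IsSymmetricGauge {n : ℕ} (ρ : (Fin n → ℝ) → ℝ) : Prop where
  add_le : ∀ x y, ρ (x + y) ≤ ρ x + ρ y
  smul : ∀ (c : ℝ) x, ρ (c • x) = |c| * ρ x
  definite : ∀ x, ρ x = 0 → x = 0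
  perm : ∀ (σ : Equiv.Perm (Fin n)) x, ρ (x ∘ σ) = ρ x
  abs : ∀ x, ρ (fun i => |x i|) = ρ x

/-- Log-majorization `x ≺_log y` of vectors with nonnegative entries in decreasing order. -/
def LogMajorized {n : ℕ} (x y : Fin n → ℝ≥0∞) : Prop :=
  (∀ k : ℕ, 1 ≤ k → k ≤ n →
    ∏ i with i.val < k, x i ≤ ∏ i with i.val < k, y i) ∧
  ∏ i, x i = ∏ i, y i

/-- The integral `∫ u⁺ - ∫ u⁻` of an extended-real function (meaningful when one of the two terms is
finite). -/
def extIntegral {Ω : Type*} [MeasurableSpace Ω] (ν : Measure Ω) (u : Ω → EReal) : EReal :=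
  ((∫⁻ τ, (u τ).toENNReal ∂ν : ℝ≥0∞) : EReal) - ((∫⁻ τ, (-(u τ)).toENNReal ∂ν : ℝ≥0∞) : EReal)

/-- `exp ∫ log h dν`, with `log 0 = -∞`, `log ∞ = ∞`, `exp (-∞) = 0`, `exp ∞ = ∞`. -/
def expIntegralLog {Ω : Type*} [MeasurableSpace Ω] (ν : Measure Ω) (h : Ω → ℝ≥0∞) : ℝ≥0∞ :=
  EReal.exp (extIntegral ν fun τ => ENNReal.log (h τ))

/-- Continuous functions `f : (0, ∞) → [0, ∞)` for which `x ↦ log f(eˣ)` is convex on `ℝ`, where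
`log 0 = -∞`. -/
structure IsLogConvexExp (f : ℝ → ℝ) : Prop where
  continuousOn : ContinuousOn f (Ioi 0)
  nonneg : ∀ x, 0 < x → 0 ≤ f x
  convex : ∀ x y a b : ℝ, 0 < a → 0 < b → a + b = 1 →
    ENNReal.log (ENNReal.ofReal (f (Real.exp (a * x + b * y)))) ≤
      (a : EReal) * ENNReal.log (ENNReal.ofReal (f (Real.exp x))) +
        (b : EReal) * ENNReal.log (ENNReal.ofReal (f (Real.exp y)))

/-- Continuous functions `g : (0, ∞) → [0, ∞)` for which `x ↦ g(eˣ)` is convex on `ℝ`. -/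
structure IsConvexExp (g : ℝ → ℝ) : Prop where
  continuousOn : ContinuousOn g (Ioi 0)
  nonneg : ∀ x, 0 < x → 0 ≤ g x
  convex : ConvexOn ℝ univ fun x => g (Real.exp x)

end

/-! Write W_i(τ) = log λ_i(D_τ). The negative moment and the uniform bound give ∫ exp(s|W_i|) dν <
∞, so almost every D_τ is TPD, each W_i is integrable, and statement 1 says that C is TPD and log
λ(C) is majorized by the mean vector ∫ W dν.

From 1 to 2 and 3: Φ(u) = log ρ(f(e^{u_i})), respectively Φ(u) = ρ(g(e^{u_i})), is convex and
permutation invariant. Hence Φ(log λ(C)) ≤ Φ(∫ W) by Rado's theorem (`ConvexOn.le_of_majorized`),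
and Φ(∫ W) ≤ ∫ Φ(W) by Jensen, in the form of an integrable affine minorant
(`ConvexOn.exists_integrable_minorant`).

Back to 1: test on Ky Fan norms and the powers x^q. Both statements yield ∑_{i≤k} λ_i(C)^q ≤ ∫
∑_{i≤k} exp(q W_i) dν, from 2 via the inequality of geometric and arithmetic means. To first order
at q = 0 this is the k-th majorization inequality; the exponential moment controls the remainder.
Negative q with k = mp gives positivity of C and the reverse inequality of the totals
(`TTensor.majorized_of_funNorm_rpow_le`).

The tensor layer reduces to the real symmetric matrix `bcirc C`, whose spectrum is that of the
Fourier blocks. -/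

namespace Matrix

/-! ### Characteristic polynomials of block diagonal and similar matrices -/

open Polynomial in
theorem charpoly_blockDiagonal {ι κ R : Type*} [Fintype ι] [DecidableEq ι] [Fintype κ]
    [DecidableEq κ] [CommRing R] (M : κ → Matrix ι ι R) :
    (blockDiagonal M).charpoly = ∏ k, (M k).charpoly := by
  have : charmatrix (blockDiagonal M) = blockDiagonal fun k => charmatrix (M k) := by
    ext ⟨i, k⟩ ⟨j, l⟩
    by_cases hkl : k = l <;> by_cases hij : i = j <;>
      simp [blockDiagonal_apply, hkl, hij]
  simp [charpoly, this, det_blockDiagonal]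

theorem charpoly_eq_of_mul_eq_mul {ι K : Type*} [Fintype ι] [DecidableEq ι] [Field K]
    {A B U : Matrix ι ι K} (hU : U.det ≠ 0) (h : A * U = U * B) : A.charpoly = B.charpoly := by
  obtain ⟨V, rfl⟩ : IsUnit U := (Matrix.isUnit_iff_isUnit_det U).2 (isUnit_iff_ne_zero.2 hU)
  rw [← charpoly_units_conj V B, ← h, mul_assoc, ← Matrix.coe_units_inv, Units.mul_inv, mul_one]

end Matrix

namespace TTensor

variable {m n l p : ℕ}

/-! ### Fourier block diagonalization -/

/-- The root of unity of the discrete Fourier transform. -/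
noncomputable def fourierRoot (p : ℕ) : ℂ := Complex.exp (2 * Real.pi * Complex.I / p)

theorem fourierRoot_isPrimitiveRoot (p : ℕ) [NeZero p] : IsPrimitiveRoot (fourierRoot p) p :=
  Complex.isPrimitiveRoot_exp p (NeZero.ne p)

/-- Addition in `Fin p` wraps around, which is harmless because exponents of ω^k only matter modulo
p. -/
theorem fourierRoot_pow_add [NeZero p] (k : ℕ) (a b : Fin p) :
    fourierRoot p ^ (k * ((a + b : Fin p) : ℕ)) =
      fourierRoot p ^ (k * (a : ℕ)) * fourierRoot p ^ (k * (b : ℕ)) := by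
  have h : (fourierRoot p ^ k) ^ p = 1 := by
    rw [← pow_mul, mul_comm, pow_mul, (fourierRoot_isPrimitiveRoot p).pow_eq_one, one_pow]
  rw [pow_mul, pow_mul, pow_mul, ← pow_add, Fin.val_add, ← pow_eq_pow_mod _ h]

theorem fourierBlock_apply (C : TTensor m m p) (k : Fin p) (i j : Fin m) :
    C.fourierBlock k i j = ∑ a : Fin p, fourierRoot p ^ ((k : ℕ) * (a : ℕ)) * (C i j a : ℂ) := by
  simp only [fourierBlock, Matrix.of_apply, fourierRoot]
  refine Finset.sum_congr rfl fun a _ => ?_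
  rw [← Complex.exp_nat_mul]
  congr 2
  push_cast
  ring

/-- The Fourier matrix intertwines `bcirc C` with the block diagonal matrix. Only its invertibility
is needed, so it is left unnormalized, as a Vandermonde matrix with the distinct nodes ω^{-k}. -/
theorem charpoly_bcirc_map [NeZero p] (C : TTensor m m p) :
    ((bcirc C).map (algebraMap ℝ ℂ)).charpoly = ∏ k, (C.fourierBlock k).charpoly := by
  rw [← Matrix.charpoly_blockDiagonal,
    ← Matrix.charpoly_reindex (Equiv.prodComm (Fin p) (Fin m))]
  have hω := fourierRoot_isPrimitiveRoot p
  have hω0 : fourierRoot p ≠ 0 := hω.ne_zero (NeZero.ne p)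
  let F : Matrix (Fin p) (Fin p) ℂ :=
    (Matrix.vandermonde fun k : Fin p => (fourierRoot p ^ (k : ℕ))⁻¹).transpose
  have hF : F.det ≠ 0 := by
    rw [Matrix.det_transpose, Matrix.det_vandermonde_ne_zero_iff]
    intro a b hab
    exact Fin.ext (hω.pow_inj a.2 b.2 (inv_injective hab))
  have hU : (Matrix.kroneckerMap (· * ·) (1 : Matrix (Fin m) (Fin m) ℂ) F).det ≠ 0 := by
    rw [Matrix.det_kronecker]
    simp [hF]
  refine Matrix.charpoly_eq_of_mul_eq_mul hU ?_
  ext ⟨i, a⟩ ⟨j, k⟩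
  simp only [Matrix.mul_apply, Fintype.sum_prod_type, Matrix.kroneckerMap_apply,
    Matrix.blockDiagonal_apply, Matrix.one_apply, Matrix.reindex_apply, Matrix.submatrix_apply,
    Matrix.map_apply, bcirc, Matrix.of_apply, F, Matrix.transpose_apply, Matrix.vandermonde_apply,
    fourierBlock_apply, Equiv.prodComm_symm, Equiv.prodComm_apply, Prod.swap]
  simp only [ite_mul, one_mul, zero_mul, mul_ite, mul_zero, Finset.sum_ite_eq, Finset.mem_univ,
    if_true, Finset.sum_ite_irrel, Finset.sum_const_zero, Finset.sum_ite_eq']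
  rw [Finset.mul_sum]
  -- Substituting c = a - b turns ∑_b C^{(a-b)} ω^{-kb} into ω^{-ka} ∑_c ω^{kc} C^{(c)}.
  refine Fintype.sum_equiv (Equiv.subLeft a) _ _ fun b => ?_
  have h := fourierRoot_pow_add (p := p) k (a - b) b
  rw [sub_add_cancel] at h
  simp only [Equiv.subLeft_apply, ← inv_pow, ← pow_mul]
  simp only [inv_pow, h]
  field_simp
  simp

/-! ### Symmetric tensors and symmetric matrices -/

theorem bcirc_injective [NeZero p] : Function.Injective (bcirc : TTensor m n p → _) :=
  Function.LeftInverse.injective bcircInv_bcirc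

theorem bcirc_transpose [NeZero p] (C : TTensor m n p) :
    bcirc C.transpose = (bcirc C).transpose := by
  ext x y
  simp [bcirc, transpose, bcircInv]

theorem isSymmetric_iff [NeZero p] {C : TTensor m m p} :
    C.IsSymmetric ↔ (bcirc C).IsHermitian := by
  rw [IsSymmetric, ← bcirc_injective.eq_iff, bcirc_transpose, Matrix.IsHermitian,
    Matrix.conjTranspose_eq_transpose_of_trivial]

theorem bcirc_tProduct [NeZero p] (C : TTensor m n p) (D : TTensor n l p) :
    bcirc (tProduct C D) = bcirc C * bcirc D := by
  ext ⟨a, i⟩ ⟨b, j⟩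
  simp only [bcirc, tProduct, fold, unfold, Matrix.of_apply, Matrix.mul_apply,
    Fintype.sum_prod_type]
  refine Fintype.sum_equiv (Equiv.addRight b) _ _ fun c => ?_
  simp [sub_sub, add_comm]

/-- The characteristic polynomial of a real symmetric matrix splits over ℝ, so all complex roots are
real and taking real parts loses nothing. -/
theorem tEigenvalueMultiset_eq [NeZero p] {C : TTensor m m p} (hC : C.IsSymmetric) :
    C.tEigenvalueMultiset = (bcirc C).charpoly.roots := by
  have hA := isSymmetric_iff.1 hC
  have h1 : ((bcirc C).map (algebraMap ℝ ℂ)).charpoly.roots =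
      (bcirc C).charpoly.roots.map (algebraMap ℝ ℂ) := by
    rw [Matrix.charpoly_map, hA.splits_charpoly.roots_map]
  have h2 : ∑ k : Fin p, (C.fourierBlock k).charpoly.roots =
      (bcirc C).charpoly.roots.map (algebraMap ℝ ℂ) := by
    rw [← h1, charpoly_bcirc_map, Polynomial.roots_prod _ _
      (Finset.prod_ne_zero_iff.2 fun k _ => (Matrix.charpoly_monic _).ne_zero)]
    rfl
  have h3 : C.tEigenvalueMultiset =
      (∑ k : Fin p, (C.fourierBlock k).charpoly.roots).map Complex.re := by
    rw [tEigenvalueMultiset]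
    exact (map_sum (Multiset.mapAddMonoidHom Complex.re) _ _).symm
  rw [h3, h2, Multiset.map_map]
  simp

theorem tEigenvalueMultiset_eq_eigenvalues [NeZero p] {C : TTensor m m p}
    (hC : C.IsSymmetric) :
    C.tEigenvalueMultiset = Finset.univ.val.map (isSymmetric_iff.1 hC).eigenvalues := by
  rw [tEigenvalueMultiset_eq hC, (isSymmetric_iff.1 hC).roots_charpoly_eq_eigenvalues]
  rfl

theorem card_tEigenvalueMultiset [NeZero p] {C : TTensor m m p} (hC : C.IsSymmetric) :
    C.tEigenvalueMultiset.card = m * p := by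
  rw [tEigenvalueMultiset_eq_eigenvalues hC]
  simp [mul_comm]

theorem map_tEigenvalues [NeZero p] {C : TTensor m m p} (hC : C.IsSymmetric) :
    Finset.univ.val.map C.tEigenvalues = C.tEigenvalueMultiset := by
  have hlen : (C.tEigenvalueMultiset.sort (fun a b : ℝ => a ≥ b)).length = m * p := by
    rw [Multiset.length_sort, card_tEigenvalueMultiset hC]
  rw [Fin.univ_val_map]
  conv_rhs => rw [← Multiset.sort_eq C.tEigenvalueMultiset (fun a b : ℝ => a ≥ b)]
  congr 1
  refine List.ext_getElem (by simp [hlen]) fun i h1 h2 => ?_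
  simp only [List.getElem_ofFn, tEigenvalues]
  exact List.getD_eq_getElem _ _ h2

theorem antitone_tEigenvalues [NeZero p] {C : TTensor m m p} (hC : C.IsSymmetric) :
    Antitone C.tEigenvalues := by
  have hlen : (C.tEigenvalueMultiset.sort (fun a b : ℝ => a ≥ b)).length = m * p := by
    rw [Multiset.length_sort, card_tEigenvalueMultiset hC]
  have hs := Multiset.pairwise_sort C.tEigenvalueMultiset (fun a b : ℝ => a ≥ b)
  intro i j hij
  rcases hij.eq_or_lt with rfl | hij
  · exact le_rfl
  have hi : (i : ℕ) < (C.tEigenvalueMultiset.sort (fun a b : ℝ => a ≥ b)).length := by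
    rw [hlen]; exact i.2
  have hj : (j : ℕ) < (C.tEigenvalueMultiset.sort (fun a b : ℝ => a ≥ b)).length := by
    rw [hlen]; exact j.2
  have := List.pairwise_iff_getElem.1 hs i j hi hj hij
  simp only [tEigenvalues]
  rwa [List.getD_eq_getElem _ _ hi, List.getD_eq_getElem _ _ hj]

theorem mem_tEigenvalueMultiset [NeZero p] {C : TTensor m m p} (hC : C.IsSymmetric) (i) :
    C.tEigenvalues i ∈ C.tEigenvalueMultiset := by
  rw [← map_tEigenvalues hC]
  exact Multiset.mem_map_of_mem _ (Finset.mem_univ_val i)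

theorem forall_tEigenvalues_iff [NeZero p] {C : TTensor m m p} (hC : C.IsSymmetric)
    (P : ℝ → Prop) :
    (∀ i, P (C.tEigenvalues i)) ↔ ∀ j, P ((isSymmetric_iff.1 hC).eigenvalues j) := by
  have h := (map_tEigenvalues hC).trans (tEigenvalueMultiset_eq_eigenvalues hC)
  have h1 : (∀ x ∈ Finset.univ.val.map C.tEigenvalues, P x) ↔ ∀ i, P (C.tEigenvalues i) := by
    simp
  rw [← h1, h]
  exact ⟨fun h j => h _ (Multiset.mem_map_of_mem _ (Finset.mem_univ_val j)), fun h x hx => by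
    obtain ⟨j, -, rfl⟩ := Multiset.mem_map.1 hx
    exact h j⟩

/-! ### Tensor functions -/

/-- Commuting with the shift by b identifies block (a, b) with block (a - b, 0), which is what
`bcircInv` reads. -/
theorem bcirc_bcircInv_of_commute [NeZero p] {M : Matrix (Fin p × Fin m) (Fin p × Fin m) ℝ}
    (h : ∀ c : Fin p, Commute M
      ((Equiv.addRight c).prodCongr (Equiv.refl (Fin m))).toPEquiv.toMatrix) :
    bcirc (bcircInv M) = M := by
  ext ⟨a, i⟩ ⟨b, j⟩
  have := congrFun (congrFun (h b).eq (a - b, i)) (b, j)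
  rw [PEquiv.mul_toMatrix_toPEquiv, PEquiv.toMatrix_toPEquiv_mul] at this
  simpa [bcirc, bcircInv] using this

theorem bcirc_commute_shift [NeZero p] (C : TTensor m m p) (c : Fin p) : Commute (bcirc C)
    ((Equiv.addRight c).prodCongr (Equiv.refl (Fin m))).toPEquiv.toMatrix := by
  rw [Commute, SemiconjBy, PEquiv.mul_toMatrix_toPEquiv, PEquiv.toMatrix_toPEquiv_mul]
  ext ⟨a, i⟩ ⟨b, j⟩
  simp [bcirc, sub_eq_add_neg, add_assoc]

/-- Whatever commutes with `bcirc C` commutes with its functional calculus; applied to the block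
shifts, this keeps f(`bcirc C`) block circulant. -/
theorem bcirc_tFun [NeZero p] (f : ℝ → ℝ) (C : TTensor m m p) :
    bcirc (tFun f C) = cfc f (bcirc C) :=
  bcirc_bcircInv_of_commute fun c => (bcirc_commute_shift C c).cfc_real f

theorem isSymmetric_tFun [NeZero p] (f : ℝ → ℝ) (C : TTensor m m p) :
    (tFun f C).IsSymmetric := by
  rw [isSymmetric_iff, bcirc_tFun]
  exact (cfc_predicate f (bcirc C)).isHermitian

theorem tEigenvalueMultiset_tFun [NeZero p] (f : ℝ → ℝ) {C : TTensor m m p}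
    (hC : C.IsSymmetric) :
    (tFun f C).tEigenvalueMultiset = C.tEigenvalueMultiset.map f := by
  rw [tEigenvalueMultiset_eq (isSymmetric_tFun f C), bcirc_tFun,
    tEigenvalueMultiset_eq_eigenvalues hC, (isSymmetric_iff.1 hC).charpoly_cfc_eq,
    Polynomial.roots_prod _ _ (Finset.prod_ne_zero_iff.2 fun i _ => Polynomial.X_sub_C_ne_zero _)]
  simp

theorem tAbs_eq_tFun [NeZero p] {C : TTensor m m p} (hC : C.IsSymmetric) :
    C.tAbs = tFun (fun x => |x|) C := by
  have hA : IsSelfAdjoint (bcirc C) := isSymmetric_iff.1 hC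
  have hsq : bcirc C * bcirc C = cfc (fun x : ℝ => x ^ 2) (bcirc C) := by
    rw [cfc_pow_id (bcirc C) 2 hA, sq]
  rw [tAbs, tFun, bcirc_tProduct, show C.transpose = C from hC, hsq,
    ← cfc_comp' Real.sqrt (fun x : ℝ => x ^ 2) (bcirc C) (by fun_prop) (by fun_prop) hA, tFun]
  simp only [Real.sqrt_sq_eq_abs]

theorem exists_perm_of_map_univ_eq {α : Type*} {n : ℕ} {f g : Fin n → α}
    (h : Finset.univ.val.map f = Finset.univ.val.map g) :
    ∃ σ : Equiv.Perm (Fin n), f = g ∘ σ := by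
  classical
  have hc : ∀ y, Nonempty ({a // f a = y} ≃ {a // g a = y}) := fun y => by
    have := congrArg (Multiset.count y) h
    rw [Multiset.count_map, Multiset.count_map] at this
    refine ⟨Fintype.equivOfCardEq ?_⟩
    simpa [Fintype.card_subtype, Finset.card_def, eq_comm] using this
  let e := fun y => (hc y).some
  refine ⟨(Equiv.sigmaFiberEquiv f).symm.trans
    ((Equiv.sigmaCongrRight e).trans (Equiv.sigmaFiberEquiv g)), funext fun i => ?_⟩
  exact (e (f i) ⟨i, rfl⟩).2.symm

/-- The T-eigenvalues of |f(C)| are the |f(λ_i)| in another order, and ρ ignores order and signs. -/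
theorem gaugeNorm_tFun [NeZero p] {ρ : (Fin (m * p) → ℝ) → ℝ} (hρ : IsSymmetricGauge ρ)
    (f : ℝ → ℝ) {C : TTensor m m p} (hC : C.IsSymmetric) :
    gaugeNorm ρ (tFun f C) = ρ fun i => f (C.tEigenvalues i) := by
  have hf := isSymmetric_tFun f C
  have h : Finset.univ.val.map (tFun f C).tAbs.tEigenvalues =
      Finset.univ.val.map fun i => |f (C.tEigenvalues i)| := by
    rw [tAbs_eq_tFun hf, map_tEigenvalues (isSymmetric_tFun _ _), tEigenvalueMultiset_tFun _ hf,
      tEigenvalueMultiset_tFun _ hC, ← map_tEigenvalues hC, Multiset.map_map, Multiset.map_map]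
    rfl
  obtain ⟨σ, hσ⟩ := exists_perm_of_map_univ_eq h
  rw [gaugeNorm, hσ, hρ.perm, hρ.abs fun i => f (C.tEigenvalues i)]

theorem abs_tEigenvalues_le_opNorm [NeZero p] {C : TTensor m m p} (hC : C.IsSymmetric) (i) :
    |C.tEigenvalues i| ≤ C.opNorm := by
  have hs := isSymmetric_tFun (fun x => |x|) C
  have h : |C.tEigenvalues i| ∈ Finset.univ.val.map C.tAbs.tEigenvalues := by
    rw [tAbs_eq_tFun hC, map_tEigenvalues hs, tEigenvalueMultiset_tFun _ hC]
    exact Multiset.mem_map_of_mem _ (mem_tEigenvalueMultiset hC i)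
  obtain ⟨j, -, hj⟩ := Multiset.mem_map.1 h
  rw [← hj]
  exact le_ciSup (Set.finite_range _).bddAbove j

theorem sum_tEigenvalues_pow [NeZero p] {C : TTensor m m p} (hC : C.IsSymmetric) (N : ℕ) :
    ∑ i, C.tEigenvalues i ^ N = (bcirc C ^ N).trace := by
  have hA : IsSelfAdjoint (bcirc C) := isSymmetric_iff.1 hC
  have hs := isSymmetric_tFun (· ^ N) C
  have h1 := Matrix.trace_eq_sum_roots_charpoly_of_splits (isSymmetric_iff.1 hs).splits_charpoly
  rw [← tEigenvalueMultiset_eq hs, bcirc_tFun, cfc_pow_id (bcirc C) N hA,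
    tEigenvalueMultiset_tFun _ hC, ← map_tEigenvalues hC, Multiset.map_map] at h1
  rw [h1]
  rfl

/-! ### Positivity -/

theorem inner_tProduct (C : TTensor m m p) (X : TTensor m 1 p) :
    inner X (tProduct C X) =
      (fun x : Fin p × Fin m => X x.2 0 x.1) ⬝ᵥ
        (bcirc C).mulVec (fun x : Fin p × Fin m => X x.2 0 x.1) := by
  simp only [inner, tProduct, fold, unfold, dotProduct, Matrix.mulVec, Matrix.mul_apply,
    Finset.univ_unique, Finset.sum_singleton, Matrix.of_apply]
  rw [Fintype.sum_prod_type, Finset.sum_comm]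
  rfl

theorem isTPSD_iff [NeZero p] {C : TTensor m m p} (hC : C.IsSymmetric) :
    C.IsTPSD ↔ ∀ i, 0 ≤ C.tEigenvalues i := by
  rw [forall_tEigenvalues_iff hC (0 ≤ ·)]
  refine Iff.trans ?_ (isSymmetric_iff.1 hC).posSemidef_iff_eigenvalues_nonneg
  rw [IsTPSD, Matrix.posSemidef_iff_dotProduct_mulVec]
  simp only [hC, isSymmetric_iff.1 hC, true_and, inner_tProduct]
  constructor
  · intro h x
    by_cases hx : x = 0
    · simp [hx]
    · refine h (fun i _ k => x (k, i)) fun h0 => hx ?_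
      ext ⟨k, i⟩
      exact congrFun (congrFun (congrFun h0 i) 0) k
  · exact fun h X _ => h _

theorem isTPD_iff [NeZero p] {C : TTensor m m p} (hC : C.IsSymmetric) :
    C.IsTPD ↔ ∀ i, 0 < C.tEigenvalues i := by
  rw [forall_tEigenvalues_iff hC (0 < ·),
    ← Matrix.IsHermitian.posDef_iff_eigenvalues_pos, IsTPD, Matrix.posDef_iff_dotProduct_mulVec]
  simp only [hC, isSymmetric_iff.1 hC, true_and, inner_tProduct]
  constructor
  · intro h x hx
    refine h (fun i _ k => x (k, i)) fun h0 => hx ?_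
    ext ⟨k, i⟩
    exact congrFun (congrFun (congrFun h0 i) 0) k
  · intro h X hX
    refine h fun h0 => hX ?_
    ext i j k
    rw [Subsingleton.elim j 0]
    exact congrFun h0 (k, i)

end TTensor

/-! ### Subgradients -/

/-- Hahn–Banach separates (u, Φ u) from the open strict epigraph. The hyperplane is not vertical,
since (u, Φ u + 1) lies in the epigraph. -/
theorem ConvexOn.exists_subgradient {E : Type*} [NormedAddCommGroup E] [NormedSpace ℝ E]
    [FiniteDimensional ℝ E] {Φ : E → ℝ} (hΦ : ConvexOn ℝ univ Φ) (u : E) :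
    ∃ φ : E →L[ℝ] ℝ, ∀ v, Φ u + φ (v - u) ≤ Φ v := by
  have hcont : Continuous Φ := hΦ.locallyLipschitz.continuous
  have hopen : IsOpen {q : E × ℝ | Φ q.1 < q.2} :=
    isOpen_lt (hcont.comp continuous_fst) continuous_snd
  have hconv : Convex ℝ {q : E × ℝ | Φ q.1 < q.2} := by
    simpa using hΦ.convex_strict_epigraph
  obtain ⟨f, hf⟩ := geometric_hahn_banach_open_point hconv hopen
    (x := (u, Φ u)) (by simp)
  have hsplit : ∀ v t, f (v, t) = f (v, 0) + t * f (0, 1) := fun v t => by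
    rw [← smul_eq_mul, ← map_smul, ← map_add]
    simp
  have hc : f (0, 1) < 0 := by
    have := hf (u, Φ u + 1) (by simp)
    rw [hsplit, hsplit u (Φ u)] at this
    linarith
  -- Otherwise raise (v, Φ v) until f equals f (u, Φ u); that point is in the strict epigraph,
  -- against strict separation.
  have hle : ∀ v, f (v, Φ v) ≤ f (u, Φ u) := fun v => by
    by_contra! h
    have := hf (v, Φ v + (f (v, Φ v) - f (u, Φ u)) / (-f (0, 1)))
      (by simpa using div_pos (sub_pos.2 h) (neg_pos.2 hc))
    rw [hsplit, add_mul, ← add_assoc, ← hsplit, div_mul_eq_mul_div, div_neg,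
      mul_div_cancel_right₀ _ hc.ne] at this
    linarith
  refine ⟨(-f (0, 1))⁻¹ • f.comp (ContinuousLinearMap.inl ℝ E ℝ), fun v => ?_⟩
  have h := hle v
  rw [hsplit, hsplit u] at h
  have h1 : f (v - u, 0) = f (v, 0) - f (u, 0) := by rw [← map_sub]; simp
  have h2 : f (v - u, 0) ≤ (Φ v - Φ u) * (-f (0, 1)) := by rw [h1]; linarith
  have h3 := (div_le_iff₀ (neg_pos.2 hc)).2 h2
  simp only [smul_apply, ContinuousLinearMap.comp_apply,
    ContinuousLinearMap.inl_apply, smul_eq_mul]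
  rw [inv_mul_eq_div]
  linarith

/-! ### Majorization -/

theorem sum_filter_val_lt_eq_sum_range {M : Type*} [AddCommMonoid M] {n k : ℕ} (hk : k ≤ n)
    (f : ℕ → M) : ∑ i : Fin n with i.val < k, f i = ∑ j ∈ Finset.range k, f j := by
  rw [Finset.sum_filter, Fin.sum_univ_eq_sum_range (fun j => if j < k then f j else 0),
    ← Finset.sum_filter]
  congr 1
  ext j
  simp only [Finset.mem_filter, Finset.mem_range]
  omega

/-- Abel summation, done by induction: nonnegative partial sums only gain from the larger weight.
The full sum may have any sign. -/
theorem mul_sum_range_le_sum_mul {d z : ℕ → ℝ} (N : ℕ) (hd : ∀ i < N, d (i + 1) ≤ d i)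
    (hz : ∀ k ≤ N, 0 ≤ ∑ i ∈ Finset.range k, z i) :
    d N * ∑ i ∈ Finset.range (N + 1), z i ≤ ∑ i ∈ Finset.range (N + 1), d i * z i := by
  induction N with
  | zero => simp
  | succ N ih =>
    rw [Finset.sum_range_succ, Finset.sum_range_succ (fun i => d i * z i), mul_add]
    have h1 := ih (fun i hi => hd i (by omega)) fun k hk => hz k (by omega)
    have h2 := mul_le_mul_of_nonneg_right (hd N (by omega)) (hz (N + 1) le_rfl)
    linarith

theorem sum_mul_le_sum_mul_of_antitone {n : ℕ} {d x y : Fin n → ℝ} (hd : Antitone d)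
    (h : ∀ k ≤ n, ∑ i with i.val < k, x i ≤ ∑ i with i.val < k, y i)
    (htot : ∑ i, x i = ∑ i, y i) : ∑ i, d i * x i ≤ ∑ i, d i * y i := by
  rcases n with - | N
  · simp
  let ext : (Fin (N + 1) → ℝ) → ℕ → ℝ := fun v j => if h : j < N + 1 then v ⟨j, h⟩ else 0
  have hext : ∀ v (i : Fin (N + 1)), ext v i = v i := fun v i => dif_pos i.2
  have hz : ∀ k ≤ N + 1, ∑ j ∈ Finset.range k, ext (y - x) j =
      ∑ i with i.val < k, y i - ∑ i with i.val < k, x i := fun k hk => by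
    rw [← sum_filter_val_lt_eq_sum_range hk, ← Finset.sum_sub_distrib]
    exact Finset.sum_congr rfl fun i _ => by rw [hext, Pi.sub_apply]
  have key := mul_sum_range_le_sum_mul (d := ext d) (z := ext (y - x)) N
    (fun i hi => by
      simp only [ext, dif_pos (show i < N + 1 by omega), dif_pos (show i + 1 < N + 1 by omega)]
      exact hd (Fin.mk_le_mk.2 (Nat.le_succ i)))
    (fun k hk => by rw [hz k (by omega)]; exact sub_nonneg.2 (h k (by omega)))
  rw [← Fin.sum_univ_eq_sum_range, ← Fin.sum_univ_eq_sum_range (fun j => ext d j * _)] at key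
  simp only [hext, Pi.sub_apply, mul_sub, Finset.sum_sub_distrib] at key
  rw [htot] at key
  linarith

/-- Rado's theorem. -/
theorem mem_convexHull_range_comp_perm {n : ℕ} {x y : Fin n → ℝ} (hx : Antitone x)
    (h : ∀ k ≤ n, ∑ i with i.val < k, x i ≤ ∑ i with i.val < k, y i)
    (htot : ∑ i, x i = ∑ i, y i) :
    x ∈ convexHull ℝ (range fun σ : Equiv.Perm (Fin n) => y ∘ σ) := by
  by_contra hnot
  obtain ⟨f, u, hf, hu⟩ := geometric_hahn_banach_closed_point (convex_convexHull ℝ _)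
    ((Set.finite_range fun σ : Equiv.Perm (Fin n) => y ∘ σ).isClosed_convexHull (𝕜 := ℝ)) hnot
  have hfc : ∀ v, f v = ∑ i, f (Pi.single i 1) * v i := fun v => by
    conv_lhs => rw [← LinearMap.sum_single_apply (fun _ => ℝ) v]
    simp only [map_sum]
    refine Finset.sum_congr rfl fun i _ => ?_
    rw [mul_comm, ← smul_eq_mul, ← map_smul, ← Pi.single_smul, smul_eq_mul, mul_one]
  let c : Fin n → ℝ := fun i => f (Pi.single i 1)
  -- σ makes the coefficients of f decreasing. Rearrangement, then Abel summation, give f x ≤ f (y ∘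
  -- σ⁻¹), contradicting the separation.
  let σ := Tuple.sort (-c)
  have hd : Antitone (c ∘ σ) := fun i j hij => by
    have := Tuple.monotone_sort (-c) hij
    simpa using this
  have h1 : f x = ∑ i, (c ∘ σ) i * x (σ i) := by
    rw [hfc]
    exact (Equiv.sum_comp σ fun i => c i * x i).symm
  have h2 : ∑ i, (c ∘ σ) i * x (σ i) ≤ ∑ i, (c ∘ σ) i * x i :=
    (hd.monovary hx).sum_mul_comp_perm_le_sum_mul
  have h3 := sum_mul_le_sum_mul_of_antitone hd h htot
  have h4 : ∑ i, (c ∘ σ) i * y i = f (y ∘ σ.symm) := by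
    rw [hfc, ← Equiv.sum_comp σ fun i => f (Pi.single i 1) * (y ∘ σ.symm) i]
    simp [c]
  have h5 := hf (y ∘ σ.symm) (subset_convexHull ℝ _ ⟨σ.symm, rfl⟩)
  linarith

theorem ConvexOn.le_of_majorized {n : ℕ} {Φ : (Fin n → ℝ) → ℝ} (hΦ : ConvexOn ℝ univ Φ)
    (hperm : ∀ (σ : Equiv.Perm (Fin n)) u, Φ (u ∘ σ) = Φ u) {x y : Fin n → ℝ} (hx : Antitone x)
    (h : ∀ k ≤ n, ∑ i with i.val < k, x i ≤ ∑ i with i.val < k, y i)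
    (htot : ∑ i, x i = ∑ i, y i) : Φ x ≤ Φ y := by
  obtain ⟨z, ⟨σ, rfl⟩, hz⟩ := hΦ.exists_ge_of_mem_convexHull (subset_univ _)
    (mem_convexHull_range_comp_perm hx h htot)
  exact hz.trans_eq (hperm σ y)

/-! ### Symmetric gauge functions -/

namespace IsSymmetricGauge

variable {n : ℕ} {ρ : (Fin n → ℝ) → ℝ}

theorem map_zero (hρ : IsSymmetricGauge ρ) : ρ 0 = 0 := by
  simpa using hρ.smul 0 0

theorem nonneg (hρ : IsSymmetricGauge ρ) (x : Fin n → ℝ) : 0 ≤ ρ x := by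
  have h1 := hρ.add_le x ((-1 : ℝ) • x)
  rw [hρ.smul, neg_one_smul, add_neg_cancel, hρ.map_zero] at h1
  simp only [abs_neg, abs_one, one_mul] at h1
  linarith

theorem pos (hρ : IsSymmetricGauge ρ) {x : Fin n → ℝ} (hx : x ≠ 0) : 0 < ρ x :=
  (hρ.nonneg x).lt_of_ne fun h => hx (hρ.definite x h.symm)

theorem smul_of_nonneg (hρ : IsSymmetricGauge ρ) {c : ℝ} (hc : 0 ≤ c) (x : Fin n → ℝ) :
    ρ (c • x) = c * ρ x := by
  rw [hρ.smul, abs_of_nonneg hc]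

theorem combo_le (hρ : IsSymmetricGauge ρ) {a b : ℝ} (ha : 0 ≤ a) (hb : 0 ≤ b)
    (x y : Fin n → ℝ) : ρ (a • x + b • y) ≤ a * ρ x + b * ρ y := by
  rw [← hρ.smul_of_nonneg ha, ← hρ.smul_of_nonneg hb]
  exact hρ.add_le _ _

theorem eq_of_abs_eq (hρ : IsSymmetricGauge ρ) {x y : Fin n → ℝ} (h : ∀ i, |x i| = |y i|) :
    ρ x = ρ y := by
  rw [← hρ.abs x, ← hρ.abs y]
  simp only [h]

/-- The shrunken vector is a convex combination of v and its reflection in coordinate i, which have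
the same norm. -/
theorem update_le (hρ : IsSymmetricGauge ρ) (v : Fin n → ℝ) (i : Fin n) {c : ℝ} (hc : 0 ≤ c)
    (hcv : c ≤ v i) : ρ (Function.update v i c) ≤ ρ v := by
  rcases (hc.trans hcv).eq_or_lt with h0 | hpos
  · have : c = v i := le_antisymm hcv (h0 ▸ hc)
    rw [this, Function.update_eq_self]
  have hflip : ρ (Function.update v i (-v i)) = ρ v := hρ.eq_of_abs_eq fun j => by
    by_cases hj : j = i
    · subst hj; simp
    · simp [Function.update_of_ne hj]
  have heq : Function.update v i c =
      ((1 + c / v i) / 2) • v + ((1 - c / v i) / 2) • Function.update v i (-v i) := by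
    ext j
    by_cases hj : j = i
    · subst hj
      simp only [Function.update_self, Pi.add_apply, Pi.smul_apply, smul_eq_mul]
      field_simp
      ring
    · simp only [Function.update_of_ne hj, Pi.add_apply, Pi.smul_apply, smul_eq_mul]
      ring
  have h1 : c / v i ≤ 1 := (div_le_one hpos).2 hcv
  have h2 : 0 ≤ c / v i := by positivity
  rw [heq]
  refine (hρ.combo_le (by linarith) (by linarith) _ _).trans_eq ?_
  rw [hflip]
  ring

theorem mono (hρ : IsSymmetricGauge ρ) {x y : Fin n → ℝ} (hx : ∀ i, 0 ≤ x i)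
    (hxy : ∀ i, x i ≤ y i) : ρ x ≤ ρ y := by
  have key : ∀ s : Finset (Fin n), ρ (s.piecewise x y) ≤ ρ y := fun s => by
    induction s using Finset.induction_on with
    | empty => simp
    | insert i s hi ih =>
      rw [Finset.piecewise_insert]
      refine (hρ.update_le _ i (hx i) ?_).trans ih
      rw [Finset.piecewise_eq_of_notMem _ _ _ hi]
      exact hxy i
  simpa using key Finset.univ

theorem convexOn_comp (hρ : IsSymmetricGauge ρ) {G : ℝ → ℝ} (hG : ConvexOn ℝ univ G)
    (hG0 : ∀ t, 0 ≤ G t) : ConvexOn ℝ univ fun u : Fin n → ℝ => ρ fun i => G (u i) := by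
  refine ⟨convex_univ, fun u _ v _ a b ha hb hab => ?_⟩
  refine (hρ.mono (fun i => hG0 _) fun i => ?_).trans
    (hρ.combo_le ha hb (fun i => G (u i)) fun i => G (v i))
  exact hG.2 (mem_univ _) (mem_univ _) ha hb hab

/-- Hölder's argument: after dividing by the norms X and Y, convexity of exp bounds each coordinate
by K(a e^{G(u_i)}/X + b e^{G(v_i)}/Y) with K = X^a Y^b, and the norm of that vector is at most K(a +
b) = K. -/
theorem convexOn_log_comp_exp [NeZero n] (hρ : IsSymmetricGauge ρ) {G : ℝ → ℝ}
    (hG : ConvexOn ℝ univ G) :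
    ConvexOn ℝ univ fun u : Fin n → ℝ => Real.log (ρ fun i => Real.exp (G (u i))) := by
  have hpos : ∀ u : Fin n → ℝ, 0 < ρ fun i => Real.exp (G (u i)) := fun u =>
    hρ.pos fun h => (Real.exp_pos (G (u 0))).ne' (congrFun h 0)
  refine ⟨convex_univ, fun u _ v _ a b ha hb hab => ?_⟩
  set X := ρ fun i => Real.exp (G (u i)) with hX
  set Y := ρ fun i => Real.exp (G (v i)) with hY
  have hX0 : 0 < X := hpos u
  have hY0 : 0 < Y := hpos v
  rw [Real.log_le_iff_le_exp (hpos _)]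
  set K := Real.exp (a • Real.log X + b • Real.log Y) with hK
  have hle : ∀ i, Real.exp (G ((a • u + b • v) i)) ≤
      ((K * a / X) • (fun i => Real.exp (G (u i))) +
        (K * b / Y) • fun i => Real.exp (G (v i))) i := fun i => by
    have h1 := hG.2 (mem_univ (u i)) (mem_univ (v i)) ha hb hab
    have h2 := convexOn_exp.2 (mem_univ (G (u i) - Real.log X))
      (mem_univ (G (v i) - Real.log Y)) ha hb hab
    simp only [smul_eq_mul, Real.exp_sub, Real.exp_log hX0, Real.exp_log hY0] at h1 h2
    calc Real.exp (G ((a • u + b • v) i))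
        ≤ Real.exp (a * G (u i) + b * G (v i)) := Real.exp_le_exp.2 h1
      _ = K * Real.exp (a * (G (u i) - Real.log X) + b * (G (v i) - Real.log Y)) := by
          rw [hK, ← Real.exp_add]
          simp only [smul_eq_mul]
          ring_nf
      _ ≤ K * (a * (Real.exp (G (u i)) / X) + b * (Real.exp (G (v i)) / Y)) :=
          mul_le_mul_of_nonneg_left h2 (Real.exp_pos _).le
      _ = _ := by
          simp only [Pi.add_apply, Pi.smul_apply, smul_eq_mul]
          ring
  have hK0 : 0 < K := Real.exp_pos _
  refine (hρ.mono (fun i => (Real.exp_pos _).le) hle).trans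
    ((hρ.combo_le (by positivity) (by positivity) _ _).trans_eq ?_)
  rw [← hX, ← hY, div_mul_cancel₀ _ hX0.ne', div_mul_cancel₀ _ hY0.ne', ← mul_add, hab, mul_one]

end IsSymmetricGauge

/-! ### Ky Fan norms -/

/-- The Ky Fan norm: the largest sum of the absolute values of `k` coordinates. -/
noncomputable def kyFan {n : ℕ} (k : ℕ) (x : Fin n → ℝ) : ℝ :=
  ⨆ σ : Equiv.Perm (Fin n), ∑ i with i.val < k, |x (σ i)|

section KyFan

variable {n k : ℕ}

theorem le_kyFan (x : Fin n → ℝ) (σ : Equiv.Perm (Fin n)) :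
    ∑ i with i.val < k, |x (σ i)| ≤ kyFan k x :=
  le_ciSup (f := fun σ : Equiv.Perm (Fin n) => ∑ i with i.val < k, |x (σ i)|)
    (Set.finite_range _).bddAbove σ

theorem kyFan_isSymmetricGauge (hk : 1 ≤ k) : IsSymmetricGauge (kyFan (n := n) k) where
  add_le x y := ciSup_le fun σ => by
    refine le_trans ?_ (add_le_add (le_kyFan x σ) (le_kyFan y σ))
    rw [← Finset.sum_add_distrib]
    exact Finset.sum_le_sum fun i _ => abs_add_le _ _
  smul c x := by
    simp only [kyFan, Pi.smul_apply, smul_eq_mul, abs_mul, ← Finset.mul_sum]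
    exact (Real.mul_iSup_of_nonneg (abs_nonneg c) _).symm
  definite x hx := by
    ext j
    have h0 : 0 < n := j.pos
    have h1 := (Finset.single_le_sum (f := fun i => |x (Equiv.swap ⟨0, h0⟩ j i)|)
      (fun i _ => abs_nonneg _) (Finset.mem_filter.2 ⟨Finset.mem_univ (⟨0, h0⟩ : Fin n), hk⟩)).trans
        (le_kyFan (k := k) x (Equiv.swap ⟨0, h0⟩ j))
    rw [hx, Equiv.swap_apply_left] at h1
    exact abs_nonpos_iff.1 h1
  perm τ x := by
    refine Equiv.iSup_congr (Equiv.mulLeft τ) fun σ => ?_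
    simp
  abs x := by simp [kyFan]

/-- Rearrangement inequality against the indicator of the first k indices. -/
theorem kyFan_of_antitone {x : Fin n → ℝ} (hx : Antitone x) (h0 : ∀ i, 0 ≤ x i) :
    kyFan k x = ∑ i with i.val < k, x i := by
  refine le_antisymm (ciSup_le fun σ => ?_) ?_
  · have hw : Antitone fun i : Fin n => if i.val < k then (1 : ℝ) else 0 := fun i j hij => by
      have : i.val ≤ j.val := hij
      dsimp only
      split_ifs
      · exact le_rfl
      · omega
      · exact zero_le_one
      · exact le_rfl
    have := (hw.monovary hx).sum_mul_comp_perm_le_sum_mul (σ := σ)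
    simp only [ite_mul, one_mul, zero_mul, ← Finset.sum_filter] at this
    simpa only [abs_of_nonneg (h0 _)] using this
  · refine le_trans (Finset.sum_le_sum fun i _ => ?_) (le_kyFan x 1)
    exact le_abs_self _

/-- No ordering is involved here, so this case also serves negative powers, which reverse the order.
-/
theorem kyFan_card (x : Fin n → ℝ) : kyFan n x = ∑ i, |x i| := by
  have h : ∀ σ : Equiv.Perm (Fin n), ∑ i with i.val < n, |x (σ i)| = ∑ i, |x i| := fun σ => by
    simp only [Fin.is_lt, Finset.filter_true]
    exact Equiv.sum_comp σ fun i => |x i|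
  simp only [kyFan, h, ciSup_const]

end KyFan

/-! ### Measurability of the T-eigenvalues -/

theorem tendsto_rpow_inv_of_le {a c : ℝ} {S : ℕ → ℝ} (ha : 0 ≤ a) (hc : 0 < c)
    (h1 : ∀ N, a ^ (N + 1) ≤ S N) (h2 : ∀ N, S N ≤ c * a ^ (N + 1)) :
    Tendsto (fun N : ℕ => S N ^ (((N + 1 : ℕ) : ℝ)⁻¹)) atTop (𝓝 a) := by
  have hinv : Tendsto (fun N : ℕ => ((N + 1 : ℕ) : ℝ)⁻¹) atTop (𝓝 0) :=
    tendsto_inv_atTop_nhds_zero_nat.comp (tendsto_add_atTop_nat 1)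
  have hlim : Tendsto (fun N : ℕ => c ^ (((N + 1 : ℕ) : ℝ)⁻¹) * a) atTop (𝓝 a) := by
    have := ((Real.continuousAt_const_rpow hc.ne').tendsto.comp hinv).mul_const a
    simpa using this
  refine tendsto_of_tendsto_of_tendsto_of_le_of_le tendsto_const_nhds hlim (fun N => ?_)
    fun N => ?_
  · have := Real.rpow_le_rpow (by positivity) (h1 N)
      (show (0 : ℝ) ≤ ((N + 1 : ℕ) : ℝ)⁻¹ by positivity)
    rwa [Real.pow_rpow_inv_natCast ha (by omega)] at this
  · have h3 : 0 ≤ S N := le_trans (by positivity) (h1 N)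
    have := Real.rpow_le_rpow h3 (h2 N)
      (show (0 : ℝ) ≤ ((N + 1 : ℕ) : ℝ)⁻¹ by positivity)
    rwa [Real.mul_rpow hc.le (by positivity), Real.pow_rpow_inv_natCast ha (by omega)] at this

/-- Peel off the coordinates from the largest down. Once those before i are removed, the power sum
lies between y_i^N and n y_i^N, so its N-th root tends to y_i. For T-eigenvalues the power sums are
traces, hence continuous in τ. -/
theorem measurable_of_measurable_sum_pow {Ω : Type*} [MeasurableSpace Ω] {n : ℕ}
    {y : Ω → Fin n → ℝ} (hanti : ∀ τ, Antitone (y τ)) (h0 : ∀ τ i, 0 ≤ y τ i)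
    (hsum : ∀ N : ℕ, Measurable fun τ => ∑ i, y τ i ^ N) (i : Fin n) :
    Measurable fun τ => y τ i := by
  induction i using WellFoundedLT.induction with
  | _ i ih =>
  have hS : ∀ N : ℕ, Measurable fun τ => ∑ j with ¬ j < i, y τ j ^ N := fun N => by
    have : (fun τ => ∑ j with ¬ j < i, y τ j ^ N) =
        fun τ => ∑ j, y τ j ^ N - ∑ j with j < i, y τ j ^ N := by
      ext τ
      rw [← Finset.sum_filter_add_sum_filter_not Finset.univ (fun j => j < i), add_sub_cancel_left]
    rw [this]
    refine (hsum N).sub (Finset.measurable_fun_sum _ fun j hj => ?_)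
    exact (ih j (Finset.mem_filter.1 hj).2).pow_const N
  refine measurable_of_tendsto_metrizable
    (f := fun N τ => (∑ j with ¬ j < i, y τ j ^ (N + 1)) ^ (((N + 1 : ℕ) : ℝ)⁻¹))
    (fun N => (hS (N + 1)).pow_const _) (tendsto_pi_nhds.2 fun τ => ?_)
  refine tendsto_rpow_inv_of_le (c := n) (h0 τ i) (Nat.cast_pos.2 i.pos) (fun N => ?_) fun N => ?_
  · exact Finset.single_le_sum (f := fun j => y τ j ^ (N + 1))
      (fun j _ => pow_nonneg (h0 τ j) _) (Finset.mem_filter.2 ⟨Finset.mem_univ i, lt_irrefl i⟩)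
  · refine (Finset.sum_le_card_nsmul _ _ (y τ i ^ (N + 1)) fun j hj => ?_).trans ?_
    · exact pow_le_pow_left₀ (h0 τ j) (hanti τ (not_lt.1 (Finset.mem_filter.1 hj).2)) _
    · rw [nsmul_eq_mul]
      refine mul_le_mul_of_nonneg_right (Nat.cast_le.2 ?_) (pow_nonneg (h0 τ i) _)
      exact (Finset.card_le_univ _).trans_eq (Fintype.card_fin n)

theorem TTensor.measurable_tEigenvalues {Ω : Type*} [TopologicalSpace Ω] [MeasurableSpace Ω]
    [OpensMeasurableSpace Ω] {m p : ℕ} [NeZero p] {D : Ω → TTensor m m p}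
    (hD : ∀ τ, (D τ).IsTPSD) (hcont : Continuous D) (i : Fin (m * p)) :
    Measurable fun τ => (D τ).tEigenvalues i := by
  refine measurable_of_measurable_sum_pow (fun τ => antitone_tEigenvalues (hD τ).1)
    (fun τ => (isTPSD_iff (hD τ).1).1 (hD τ)) (fun N => ?_) i
  simp only [fun τ => sum_tEigenvalues_pow (hD τ).1 N]
  have hb : Continuous fun τ => bcirc (D τ) := continuous_matrix fun x y => by
    simp only [bcirc, Matrix.of_apply]
    fun_prop
  exact (hb.pow N).matrix_trace.measurable

/-! ### Integrals of extended real functions -/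

section Integral

variable {Ω : Type*} [MeasurableSpace Ω] {ν : Measure Ω}

/-- Lower Lebesgue integrals are monotone without measurability, so τ ↦ ‖f(D_τ)‖_ρ never has to be
shown measurable. -/
theorem extIntegral_mono_ae {u v : Ω → EReal} (h : ∀ᵐ τ ∂ν, u τ ≤ v τ) :
    extIntegral ν u ≤ extIntegral ν v := by
  refine EReal.sub_le_sub ?_ ?_
  · refine EReal.coe_ennreal_le_coe_ennreal_iff.2 (lintegral_mono_ae ?_)
    filter_upwards [h] with τ hτ using EReal.toENNReal_le_toENNReal hτ
  · refine EReal.coe_ennreal_le_coe_ennreal_iff.2 (lintegral_mono_ae ?_)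
    filter_upwards [h] with τ hτ using EReal.toENNReal_le_toENNReal (EReal.neg_le_neg_iff.2 hτ)

theorem extIntegral_coe {f : Ω → ℝ} (hf : Integrable f ν) :
    extIntegral ν (fun τ => (f τ : EReal)) = ((∫ τ, f τ ∂ν : ℝ) : EReal) := by
  have h1 : ∫⁻ τ, ENNReal.ofReal (f τ) ∂ν ≠ ∞ :=
    ((lintegral_ofReal_le_lintegral_enorm _).trans_lt hf.hasFiniteIntegral).ne
  have h2 : ∫⁻ τ, ENNReal.ofReal (-f τ) ∂ν ≠ ∞ :=
    ((lintegral_ofReal_le_lintegral_enorm _).trans_lt hf.neg.hasFiniteIntegral).ne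
  rw [integral_eq_lintegral_pos_part_sub_lintegral_neg_part hf, EReal.coe_sub,
    EReal.coe_ennreal_toReal h1, EReal.coe_ennreal_toReal h2]
  rfl

theorem expIntegralLog_mono_ae {u v : Ω → ℝ≥0∞} (h : ∀ᵐ τ ∂ν, u τ ≤ v τ) :
    expIntegralLog ν u ≤ expIntegralLog ν v :=
  EReal.exp_monotone (extIntegral_mono_ae (h.mono fun _ hτ => ENNReal.log_le_log hτ))

theorem expIntegralLog_ofReal_exp {f : Ω → ℝ} (hf : Integrable f ν) :
    expIntegralLog ν (fun τ => ENNReal.ofReal (Real.exp (f τ))) =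
      ENNReal.ofReal (Real.exp (∫ τ, f τ ∂ν)) := by
  simp only [expIntegralLog, ENNReal.log_ofReal_of_pos (Real.exp_pos _), Real.log_exp,
    extIntegral_coe hf, EReal.exp_coe]

theorem expIntegralLog_congr_ae {u v : Ω → ℝ≥0∞} (h : ∀ᵐ τ ∂ν, u τ = v τ) :
    expIntegralLog ν u = expIntegralLog ν v :=
  le_antisymm (expIntegralLog_mono_ae (h.mono fun _ hτ => hτ.le))
    (expIntegralLog_mono_ae (h.mono fun _ hτ => hτ.ge))

/-- Jensen's inequality between the geometric and the arithmetic mean. -/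
theorem expIntegralLog_ofReal_le [IsProbabilityMeasure ν] {S : Ω → ℝ} (hS : Integrable S ν)
    (hpos : ∀ τ, 0 < S τ) :
    expIntegralLog ν (fun τ => ENNReal.ofReal (S τ)) ≤ ENNReal.ofReal (∫ τ, S τ ∂ν) := by
  have hA : 0 < ∫ τ, S τ ∂ν := by
    rw [integral_pos_iff_support_of_nonneg (fun τ => (hpos τ).le) hS,
      show Function.support S = univ from eq_univ_of_forall fun τ => (hpos τ).ne']
    simp
  set A := ∫ τ, S τ ∂ν with hAdef
  -- The tangent to log at the mean A lies above log S and integrates to log A.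
  have hint : Integrable (fun τ => Real.log A + (S τ / A - 1)) ν := by fun_prop
  calc expIntegralLog ν (fun τ => ENNReal.ofReal (S τ))
      ≤ expIntegralLog ν fun τ => ENNReal.ofReal (Real.exp (Real.log A + (S τ / A - 1))) := by
        refine expIntegralLog_mono_ae (Eventually.of_forall fun τ => ENNReal.ofReal_le_ofReal ?_)
        rw [Real.exp_add, Real.exp_log hA]
        have := Real.add_one_le_exp (S τ / A - 1)
        calc S τ = A * (S τ / A - 1 + 1) := by field_simp; ring
          _ ≤ _ := mul_le_mul_of_nonneg_left this hA.le
    _ = ENNReal.ofReal A := by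
        rw [expIntegralLog_ofReal_exp hint, integral_add (by fun_prop) (by fun_prop),
          integral_sub (hS.div_const _) (integrable_const _), integral_div, ← hAdef]
        simp [hA.ne', Real.exp_log hA]

/-! ### Functions with exponential moments -/

theorem Real.exp_le_one_add_add_sq_mul_exp_abs (x : ℝ) :
    Real.exp x ≤ 1 + x + x ^ 2 * Real.exp |x| := by
  have h1 : 1 ≤ Real.exp |x| := Real.one_le_exp (abs_nonneg x)
  by_cases hx : |x| ≤ 1
  · have h2 := (abs_le.1 (Real.abs_exp_sub_one_sub_id_le hx)).2
    nlinarith [sq_nonneg x]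
  · push Not at hx
    have h2 : 1 ≤ x ^ 2 := by rw [← sq_abs]; nlinarith
    rcases le_or_gt 0 x with h | h
    · have : Real.exp x ≤ Real.exp |x| := Real.exp_le_exp.2 (le_abs_self x)
      nlinarith
    · have h3 : Real.exp x ≤ 1 := Real.exp_le_one_iff.2 h.le
      rw [abs_of_neg h] at hx h1 ⊢
      nlinarith

variable {s : ℝ} {W : Ω → ℝ}

theorem integrable_of_integrable_exp_abs (hs : 0 < s) (hW : Measurable W)
    (h : Integrable (fun τ => Real.exp (s * |W τ|)) ν) : Integrable W ν := by
  refine (h.const_mul s⁻¹).mono' hW.aestronglyMeasurable (Eventually.of_forall fun τ => ?_)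
  rw [Real.norm_eq_abs, inv_mul_eq_div, le_div_iff₀ hs]
  linarith [Real.add_one_le_exp (s * |W τ|)]

theorem integrable_exp_mul_of_abs_le (hW : Measurable W)
    (h : Integrable (fun τ => Real.exp (s * |W τ|)) ν) {q : ℝ} (hq : |q| ≤ s) :
    Integrable (fun τ => Real.exp (q * W τ)) ν := by
  refine h.mono' (by fun_prop) (Eventually.of_forall fun τ => ?_)
  rw [Real.norm_eq_abs, Real.abs_exp, Real.exp_le_exp]
  refine (le_abs_self _).trans ?_
  rw [abs_mul]
  exact mul_le_mul_of_nonneg_right hq (abs_nonneg _)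

/-- First-order expansion at q = 0 with a remainder uniform in q: one factor exp(s|W|/2) absorbs
exp|qW|, the other absorbs W². -/
theorem integral_exp_mul_le [IsProbabilityMeasure ν] (hs : 0 < s) (hW : Measurable W)
    (h : Integrable (fun τ => Real.exp (s * |W τ|)) ν) {q : ℝ} (hq : |q| ≤ s / 2) :
    ∫ τ, Real.exp (q * W τ) ∂ν ≤
      1 + q * ∫ τ, W τ ∂ν + q ^ 2 * (8 / s ^ 2 * ∫ τ, Real.exp (s * |W τ|) ∂ν) := by
  have hWi := integrable_of_integrable_exp_abs hs hW h
  have hpt : ∀ τ, Real.exp (q * W τ) ≤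
      1 + q * W τ + q ^ 2 * (8 / s ^ 2 * Real.exp (s * |W τ|)) := fun τ => by
    have h1 := Real.exp_le_one_add_add_sq_mul_exp_abs (q * W τ)
    have h2 : Real.exp |q * W τ| ≤ Real.exp (s / 2 * |W τ|) := by
      rw [Real.exp_le_exp, abs_mul]
      exact mul_le_mul_of_nonneg_right hq (abs_nonneg _)
    -- The constant comes from t²/2 ≤ e^t at t = s|W|/2.
    have h3 : W τ ^ 2 ≤ 8 / s ^ 2 * Real.exp (s / 2 * |W τ|) := by
      have := Real.quadratic_le_exp_of_nonneg (show 0 ≤ s / 2 * |W τ| by positivity)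
      have h4 : (s / 2 * |W τ|) ^ 2 / 2 ≤ Real.exp (s / 2 * |W τ|) := by
        have : 0 ≤ s / 2 * |W τ| := by positivity
        linarith
      rw [mul_pow, sq_abs] at h4
      rw [div_mul_eq_mul_div, le_div_iff₀ (by positivity)]
      linarith
    have h5 : Real.exp (s * |W τ|) = Real.exp (s / 2 * |W τ|) * Real.exp (s / 2 * |W τ|) := by
      rw [← Real.exp_add]; ring_nf
    have h6 : (q * W τ) ^ 2 * Real.exp |q * W τ| ≤
        q ^ 2 * (8 / s ^ 2 * Real.exp (s * |W τ|)) := by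
      rw [h5, mul_pow, mul_assoc, ← mul_assoc (8 / s ^ 2)]
      refine mul_le_mul_of_nonneg_left ?_ (sq_nonneg q)
      exact mul_le_mul h3 h2 (Real.exp_pos _).le (by positivity)
    linarith
  refine (integral_mono (integrable_exp_mul_of_abs_le hW h (hq.trans (by linarith)))
    (by fun_prop) hpt).trans_eq ?_
  rw [integral_add (by fun_prop) (by fun_prop), integral_add (by fun_prop) (by fun_prop)]
  simp [integral_const_mul]

/-- exp(s|log y|) is the larger of y^s, which is bounded, and y^{-s}, which is integrable. -/
theorem integrable_exp_abs_log {y : Ω → ℝ} [IsFiniteMeasure ν] (hs : 0 < s) (hy : Measurable y)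
    (hpos : ∀ᵐ τ ∂ν, 0 < y τ) {M : ℝ} (hM : ∀ τ, y τ ≤ M)
    (hint : Integrable (fun τ => y τ ^ (-s)) ν) :
    Integrable (fun τ => Real.exp (s * |Real.log (y τ)|)) ν := by
  refine (hint.add (integrable_const (M ^ s))).mono'
    ((hy.log.norm.const_mul s).exp.aestronglyMeasurable) ?_
  filter_upwards [hpos] with τ hτ
  rw [Real.norm_eq_abs, Real.abs_exp, Pi.add_apply]
  have h1 : y τ ^ s ≤ M ^ s := Real.rpow_le_rpow hτ.le (hM τ) hs.le
  have h2 : 0 < y τ ^ s := Real.rpow_pos_of_pos hτ s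
  have h3 : 0 < y τ ^ (-s) := Real.rpow_pos_of_pos hτ _
  rcases abs_cases (Real.log (y τ)) with ⟨h, -⟩ | ⟨h, -⟩
  · rw [h, mul_comm, ← Real.rpow_def_of_pos hτ]
    linarith
  · rw [h, mul_neg, ← neg_mul, mul_comm, ← Real.rpow_def_of_pos hτ]
    linarith

/-- As h need not be measurable, it is bounded below by the measurable g, which sees only coordinate
i: monotonicity of ρ gives ρ(v) ≥ ρ(e_i) v_i for nonnegative v. -/
theorem ae_pos_and_integrable_rpow {n : ℕ} {y : Ω → Fin n → ℝ}
    (hy : ∀ i, Measurable fun τ => y τ i) {ρ : (Fin n → ℝ) → ℝ}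
    (hρ : IsSymmetricGauge ρ) {h : Ω → ℝ≥0∞} (h0 : ∀ τ i, 0 ≤ y τ i)
    (hpos : ∀ τ, (∀ i, 0 < y τ i) → h τ = ENNReal.ofReal (ρ fun i => y τ i ^ (-s)))
    (htop : ∀ τ, (¬ ∀ i, 0 < y τ i) → h τ = ∞) (hint : ∫⁻ τ, h τ ∂ν < ∞) (i : Fin n) :
    (∀ᵐ τ ∂ν, 0 < y τ i) ∧ Integrable (fun τ => y τ i ^ (-s)) ν := by
  classical
  set c := ρ (Pi.single i 1) with hc
  have hc0 : 0 < c := hρ.pos (by simp)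
  let g : Ω → ℝ≥0∞ := fun τ => if 0 < y τ i then ENNReal.ofReal (c * y τ i ^ (-s)) else ∞
  have hg : Measurable g := by
    refine Measurable.ite (measurableSet_lt measurable_const (hy i)) ?_ measurable_const
    have := hy i
    fun_prop
  have hgh : ∀ τ, g τ ≤ h τ := fun τ => by
    by_cases hτ : ∀ i, 0 < y τ i
    · simp only [g, if_pos (hτ i), hpos τ hτ]
      refine ENNReal.ofReal_le_ofReal ?_
      have h1 : 0 ≤ y τ i ^ (-s) := Real.rpow_nonneg (h0 τ i) _
      rw [hc, mul_comm, ← hρ.smul_of_nonneg h1]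
      refine hρ.mono (fun j => ?_) fun j => ?_ <;> by_cases hj : j = i
      · subst hj; simpa using h1
      · simp [hj]
      · subst hj; simp
      · simpa [hj] using Real.rpow_nonneg (h0 τ j) _
    · rw [htop τ hτ]
      exact le_top
  have hgint : ∫⁻ τ, g τ ∂ν < ∞ := (lintegral_mono hgh).trans_lt hint
  have hae : ∀ᵐ τ ∂ν, 0 < y τ i := by
    filter_upwards [ae_lt_top hg hgint.ne] with τ hτ
    by_contra hn
    simp [g, hn] at hτ
  refine ⟨hae, ?_⟩
  have hm : Measurable fun τ => c * y τ i ^ (-s) := by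
    have := hy i
    fun_prop
  have h2 : Integrable (fun τ => c * y τ i ^ (-s)) ν := by
    refine (lintegral_ofReal_ne_top_iff_integrable hm.aestronglyMeasurable
      (Eventually.of_forall fun τ => mul_nonneg hc0.le (Real.rpow_nonneg (h0 τ i) _))).1 ?_
    rw [lintegral_congr_ae (g := g) (hae.mono fun τ hτ => by simp [g, hτ])]
    exact hgint.ne
  simpa [hc0.ne'] using h2.const_mul c⁻¹

end Integral

/-! ### Power functions -/

theorem exp_rpow_eq (x q : ℝ) : Real.exp x ^ q = Real.exp (q * x) := by
  rw [mul_comm, Real.exp_mul]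

theorem isLogConvexExp_rpow (q : ℝ) : IsLogConvexExp fun x => x ^ q where
  continuousOn := fun x hx => (Real.continuousAt_rpow_const x q (Or.inl hx.ne')).continuousWithinAt
  nonneg x hx := Real.rpow_nonneg hx.le q
  convex x y a b _ _ _ := by
    simp only [exp_rpow_eq, ENNReal.log_ofReal_of_pos (Real.exp_pos _), Real.log_exp]
    rw [← EReal.coe_mul, ← EReal.coe_mul, ← EReal.coe_add, EReal.coe_le_coe_iff]
    exact le_of_eq (by ring)

theorem isConvexExp_rpow (q : ℝ) : IsConvexExp fun x => x ^ q where
  continuousOn := fun x hx => (Real.continuousAt_rpow_const x q (Or.inl hx.ne')).continuousWithinAt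
  nonneg x hx := Real.rpow_nonneg hx.le q
  convex := by
    simp only [exp_rpow_eq]
    exact convexOn_exp.comp_linearMap (LinearMap.mul ℝ ℝ q)

theorem not_tendsto_rpow_neg {q : ℝ} (hq : q < 0) :
    ¬ ∃ c : ℝ, Tendsto (fun x : ℝ => x ^ q) (𝓝[>] (0 : ℝ)) (𝓝 c) := by
  rintro ⟨c, hc⟩
  exact not_tendsto_nhds_of_tendsto_atTop (tendsto_rpow_neg_nhdsGT_zero hq) c hc

/-! ### Functions that are log-convex in the exponential scale -/

theorem IsLogConvexExp.eq_zero_of_eq_zero {f : ℝ → ℝ} (hf : IsLogConvexExp f) {x : ℝ}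
    (hx : f (Real.exp x) = 0) (z : ℝ) : f (Real.exp z) = 0 := by
  -- z is the midpoint of x and 2z - x, and a value -∞ at one end forces -∞ at the midpoint.
  have h := hf.convex x (2 * z - x) (1 / 2) (1 / 2) (by norm_num) (by norm_num) (by norm_num)
  rw [hx, ENNReal.ofReal_zero, ENNReal.log_zero, EReal.coe_mul_bot_of_pos (by norm_num),
    EReal.bot_add, le_bot_iff, ENNReal.log_eq_bot_iff, ENNReal.ofReal_eq_zero,
    show 1 / 2 * x + 1 / 2 * (2 * z - x) = z by ring] at h
  exact le_antisymm h (hf.nonneg _ (Real.exp_pos z))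

theorem IsLogConvexExp.eq_zero_or_convexOn {f : ℝ → ℝ} (hf : IsLogConvexExp f) :
    (∀ x, f (Real.exp x) = 0) ∨ (∀ x, 0 < f (Real.exp x)) ∧
      ConvexOn ℝ univ fun x => Real.log (f (Real.exp x)) := by
  by_cases h : ∃ x, f (Real.exp x) = 0
  · obtain ⟨x, hx⟩ := h
    exact Or.inl (hf.eq_zero_of_eq_zero hx)
  · push Not at h
    have hpos : ∀ x, 0 < f (Real.exp x) := fun x =>
      (hf.nonneg _ (Real.exp_pos x)).lt_of_ne' (h x)
    refine Or.inr ⟨hpos, convexOn_iff_forall_pos.2 ⟨convex_univ, ?_⟩⟩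
    intro x _ y _ a b ha hb hab
    have := hf.convex x y a b ha hb hab
    rwa [ENNReal.log_ofReal_of_pos (hpos _), ENNReal.log_ofReal_of_pos (hpos _),
      ENNReal.log_ofReal_of_pos (hpos _), ← EReal.coe_mul, ← EReal.coe_mul, ← EReal.coe_add,
      EReal.coe_le_coe_iff] at this

/-! ### Norms of functions of a tensor -/

namespace TTensor

variable {m p : ℕ} [NeZero p] {C : TTensor m m p}

theorem funNorm_of_pos {ρ : (Fin (m * p) → ℝ) → ℝ} (hρ : IsSymmetricGauge ρ) (f : ℝ → ℝ)
    (hC : C.IsSymmetric) (hpos : ∀ i, 0 < C.tEigenvalues i) :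
    funNorm ρ f C = ENNReal.ofReal (ρ fun i => f (C.tEigenvalues i)) := by
  rw [funNorm, if_pos (Or.inl ((isTPD_iff hC).2 hpos)), gaugeNorm_tFun hρ _ hC]
  simp only [extendAtZero, hpos, if_true]

theorem funNorm_of_pos_exp_log {ρ : (Fin (m * p) → ℝ) → ℝ} (hρ : IsSymmetricGauge ρ)
    (f : ℝ → ℝ) (hC : C.IsSymmetric) (hpos : ∀ i, 0 < C.tEigenvalues i) :
    funNorm ρ f C =
      ENNReal.ofReal (ρ fun i => f (Real.exp (Real.log (C.tEigenvalues i)))) := by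
  simp only [funNorm_of_pos hρ f hC hpos, Real.exp_log (hpos _)]

theorem funNorm_rpow_of_not_pos (ρ : (Fin (m * p) → ℝ) → ℝ) {q : ℝ} (hq : q < 0)
    (hC : C.IsSymmetric) (hpos : ¬ ∀ i, 0 < C.tEigenvalues i) :
    funNorm ρ (fun x => x ^ q) C = ∞ := by
  rw [funNorm, if_neg]
  rw [isTPD_iff hC, not_or]
  exact ⟨hpos, not_tendsto_rpow_neg hq⟩

theorem funNorm_kyFan_rpow {k : ℕ} (hk : 1 ≤ k) {q : ℝ} (hq : 0 ≤ q ∨ k = m * p)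
    (hC : C.IsSymmetric) (hpos : ∀ i, 0 < C.tEigenvalues i) :
    funNorm (kyFan k) (fun x => x ^ q) C =
      ENNReal.ofReal (∑ i with i.val < k, Real.exp (q * Real.log (C.tEigenvalues i))) := by
  have h0 : ∀ i, 0 ≤ C.tEigenvalues i ^ q := fun i => Real.rpow_nonneg (hpos i).le q
  have hexp : ∀ i, Real.exp (q * Real.log (C.tEigenvalues i)) = C.tEigenvalues i ^ q :=
    fun i => by rw [Real.rpow_def_of_pos (hpos i), mul_comm]
  rw [funNorm_of_pos (kyFan_isSymmetricGauge hk) _ hC hpos]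
  simp only [hexp]
  rcases hq with hq | rfl
  · rw [kyFan_of_antitone (fun i j hij => ?_) h0]
    exact Real.rpow_le_rpow (hpos j).le (antitone_tEigenvalues hC hij) hq
  · simp only [kyFan_card, abs_of_nonneg (h0 _), Fin.is_lt, Finset.filter_true]

end TTensor

/-! ### Log-majorization -/

/-- Equality of the full products, with a positive right side, rules out zeros among the x_i; then
logarithms can be taken. -/
theorem logMajorized_ofReal_iff {n : ℕ} {x L : Fin n → ℝ} (hx : ∀ i, 0 ≤ x i) :
    LogMajorized (fun i => ENNReal.ofReal (x i)) (fun i => ENNReal.ofReal (Real.exp (L i))) ↔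
      (∀ i, 0 < x i) ∧
        (∀ k ≤ n, ∑ i with i.val < k, Real.log (x i) ≤ ∑ i with i.val < k, L i) ∧
        ∑ i, Real.log (x i) = ∑ i, L i := by
  have hL : ∀ s : Finset (Fin n), ∏ i ∈ s, ENNReal.ofReal (Real.exp (L i)) =
      ENNReal.ofReal (Real.exp (∑ i ∈ s, L i)) := fun s => by
    rw [← ENNReal.ofReal_prod_of_nonneg fun i _ => (Real.exp_pos _).le, Real.exp_sum]
  have hX : (∀ i, 0 < x i) → ∀ s : Finset (Fin n), ∏ i ∈ s, ENNReal.ofReal (x i) =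
      ENNReal.ofReal (Real.exp (∑ i ∈ s, Real.log (x i))) := fun hpos s => by
    rw [← ENNReal.ofReal_prod_of_nonneg fun i _ => hx i, Real.exp_sum]
    simp only [Real.exp_log (hpos _)]
  constructor
  · rintro ⟨h1, h2⟩
    have hpos : ∀ i, 0 < x i := fun i => by
      rw [hL] at h2
      by_contra hi
      rw [Finset.prod_eq_zero (Finset.mem_univ i) (ENNReal.ofReal_eq_zero.2 (not_lt.1 hi))] at h2
      exact (ENNReal.ofReal_pos.2 (Real.exp_pos _)).ne h2
    refine ⟨hpos, fun k hk => ?_, ?_⟩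
    · rcases Nat.eq_zero_or_pos k with rfl | hk0
      · simp
      · have := h1 k hk0 hk
        rwa [hL, hX hpos, ENNReal.ofReal_le_ofReal_iff (Real.exp_pos _).le,
          Real.exp_le_exp] at this
    · rwa [hL, hX hpos, ENNReal.ofReal_eq_ofReal_iff (Real.exp_pos _).le (Real.exp_pos _).le,
        Real.exp_eq_exp] at h2
  · rintro ⟨hpos, h1, h2⟩
    refine ⟨fun k _ hk => ?_, ?_⟩
    · rw [hL, hX hpos]
      exact ENNReal.ofReal_le_ofReal (Real.exp_le_exp.2 (h1 k hk))
    · rw [hL, hX hpos, h2]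

/-! ### Jensen's inequality -/

section Jensen

variable {Ω : Type*} [MeasurableSpace Ω] {ν : Measure Ω} [IsProbabilityMeasure ν] {n : ℕ}

/-- The minorant is the supporting affine function at the mean, composed with W. It gives Jensen's
inequality even where Φ ∘ W is not integrable. -/
theorem ConvexOn.exists_integrable_minorant {Φ : (Fin n → ℝ) → ℝ} (hΦ : ConvexOn ℝ univ Φ)
    {W : Ω → Fin n → ℝ} (hW : ∀ i, Integrable (fun τ => W τ i) ν) :
    ∃ ℓ : Ω → ℝ, Integrable ℓ ν ∧ (∀ τ, ℓ τ ≤ Φ (W τ)) ∧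
      ∫ τ, ℓ τ ∂ν = Φ fun i => ∫ τ, W τ i ∂ν := by
  set u : Fin n → ℝ := fun i => ∫ τ, W τ i ∂ν with hu
  obtain ⟨φ, hφ⟩ := hΦ.exists_subgradient u
  have hWi : Integrable W ν := Integrable.of_eval hW
  have hWu : ∫ τ, W τ ∂ν = u := by
    ext i
    rw [eval_integral hW]
  have hsub : Integrable (fun τ => W τ - u) ν := hWi.sub (integrable_const u)
  refine ⟨fun τ => Φ u + φ (W τ - u), (integrable_const _).add (φ.integrable_comp hsub),
    fun τ => hφ (W τ), ?_⟩
  rw [integral_add (integrable_const _) (φ.integrable_comp hsub), φ.integral_comp_comm hsub,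
    integral_sub hWi (integrable_const u), hWu]
  simp

end Jensen

/-! ### Log-majorization versus norm inequalities -/

theorem le_of_forall_mul_le_mul_add_sq {A B K δ : ℝ} (hδ : 0 < δ)
    (h : ∀ q, 0 < q → q ≤ δ → q * A ≤ q * B + q ^ 2 * K) : A ≤ B := by
  have hlim : Tendsto (fun q : ℝ => B + q * K) (𝓝[>] 0) (𝓝 B) := by
    have : Tendsto (fun q : ℝ => B + q * K) (𝓝 0) (𝓝 (B + 0 * K)) :=
      Continuous.tendsto (by fun_prop) 0
    rw [zero_mul, add_zero] at this
    exact this.mono_left nhdsWithin_le_nhds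
  refine ge_of_tendsto hlim ?_
  filter_upwards [Ioc_mem_nhdsGT hδ] with q hq
  refine le_of_mul_le_mul_left ?_ hq.1
  linarith [h q hq.1 hq.2]

theorem ofReal_integral_le_lintegral_ofReal {Ω : Type*} [MeasurableSpace Ω] {ν : Measure Ω}
    {f : Ω → ℝ} (hf : Integrable f ν) :
    ENNReal.ofReal (∫ τ, f τ ∂ν) ≤ ∫⁻ τ, ENNReal.ofReal (f τ) ∂ν := by
  refine ENNReal.ofReal_le_of_le_toReal ?_
  rw [integral_eq_lintegral_pos_part_sub_lintegral_neg_part hf]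
  linarith [ENNReal.toReal_nonneg (a := ∫⁻ τ, ENNReal.ofReal (-f τ) ∂ν)]

section

variable {Ω : Type*} [MeasurableSpace Ω] {ν : Measure Ω} [IsProbabilityMeasure ν] {m p : ℕ}
  [NeZero p] {C : TTensor m m p} {D : Ω → TTensor m m p}

/-- The norms of the powers `C ^ q` for small `q` determine the log-majorization. -/
theorem TTensor.majorized_of_funNorm_rpow_le (hC : C.IsTPSD) {s : ℝ} (hs : 0 < s)
    {W : Ω → Fin (m * p) → ℝ} (hW : ∀ i, Measurable fun τ => W τ i)
    (hexp : ∀ i, Integrable (fun τ => Real.exp (s * |W τ i|)) ν)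
    (h : ∀ k, 1 ≤ k → k ≤ m * p → ∀ q, |q| ≤ s / 2 → (0 ≤ q ∨ k = m * p) →
      funNorm (kyFan k) (fun x => x ^ q) C ≤
        ENNReal.ofReal (∫ τ, ∑ i with i.val < k, Real.exp (q * W τ i) ∂ν)) :
    (∀ i, 0 < C.tEigenvalues i) ∧
      (∀ k ≤ m * p, ∑ i with i.val < k, Real.log (C.tEigenvalues i) ≤
        ∑ i with i.val < k, ∫ τ, W τ i ∂ν) ∧
      ∑ i, Real.log (C.tEigenvalues i) = ∑ i, ∫ τ, W τ i ∂ν := by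
  -- At q = -s/2 the left side would be ∞ for a singular C, while the right side is finite.
  have hpos : ∀ i, 0 < C.tEigenvalues i := by
    by_contra hn
    have hk : 1 ≤ m * p := by
      obtain ⟨i, -⟩ := not_forall.1 hn
      exact i.pos
    have := h (m * p) hk le_rfl (-(s / 2))
      (by rw [abs_neg, abs_of_pos (by positivity)]) (Or.inr rfl)
    rw [funNorm_rpow_of_not_pos _ (by linarith) hC.1 hn, top_le_iff] at this
    exact ENNReal.ofReal_ne_top this
  have key : ∀ k, 1 ≤ k → k ≤ m * p → ∀ q, |q| ≤ s / 2 → (0 ≤ q ∨ k = m * p) →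
      q * ∑ i with i.val < k, Real.log (C.tEigenvalues i) ≤
        q * ∑ i with i.val < k, ∫ τ, W τ i ∂ν + q ^ 2 *
          ∑ i : Fin (m * p) with i.val < k, 8 / s ^ 2 * ∫ τ, Real.exp (s * |W τ i|) ∂ν := by
    intro k hk hkn q hq hqk
    have h1 := h k hk hkn q hq hqk
    have hint : ∀ i, Integrable (fun τ => Real.exp (q * W τ i)) ν := fun i =>
      integrable_exp_mul_of_abs_le (hW i) (hexp i) (hq.trans (by linarith))
    rw [funNorm_kyFan_rpow hk hqk hC.1 hpos, ENNReal.ofReal_le_ofReal_iff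
      (integral_nonneg fun τ => Finset.sum_nonneg fun i _ => (Real.exp_pos _).le),
      integral_finsetSum _ fun i _ => hint i] at h1
    -- Bounded below by t + 1 ≤ e^t and above by the expansion, the two sides have the same
    -- zeroth-order term, which cancels.
    have h2 : ∑ i with i.val < k, (q * Real.log (C.tEigenvalues i) + 1) ≤
        ∑ i with i.val < k, Real.exp (q * Real.log (C.tEigenvalues i)) :=
      Finset.sum_le_sum fun i _ => Real.add_one_le_exp _
    have h3 := Finset.sum_le_sum (s := Finset.univ.filter fun i : Fin (m * p) => i.val < k)
      fun i _ => integral_exp_mul_le hs (hW i) (hexp i) hq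
    simp only [Finset.sum_add_distrib, ← Finset.mul_sum] at h2 h3 ⊢
    linarith
  have hle : ∀ k ≤ m * p, ∑ i with i.val < k, Real.log (C.tEigenvalues i) ≤
      ∑ i with i.val < k, ∫ τ, W τ i ∂ν := fun k hkn => by
    rcases Nat.eq_zero_or_pos k with rfl | hk
    · simp
    · exact le_of_forall_mul_le_mul_add_sq (half_pos hs) fun q hq0 hq =>
        key k hk hkn q (by rwa [abs_of_pos hq0]) (Or.inl hq0.le)
  refine ⟨hpos, hle, ?_⟩
  have huniv : (Finset.univ.filter fun i : Fin (m * p) => i.val < m * p) = Finset.univ := by simp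
  rcases Nat.eq_zero_or_pos (m * p) with hn | hn
  · have : IsEmpty (Fin (m * p)) := by rw [hn]; infer_instance
    simp
  refine le_antisymm ?_ ?_
  · simpa only [huniv] using hle (m * p) le_rfl
  -- Negative exponents, available for k = mp, give the reverse inequality of the totals.
  · refine neg_le_neg_iff.1 (le_of_forall_mul_le_mul_add_sq
      (K := ∑ i : Fin (m * p), 8 / s ^ 2 * ∫ τ, Real.exp (s * |W τ i|) ∂ν) (half_pos hs)
      fun q hq0 hq => ?_)
    have := key (m * p) hn le_rfl (-q) (by rwa [abs_neg, abs_of_pos hq0]) (Or.inr rfl)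
    rw [huniv, neg_sq] at this
    linarith

theorem TTensor.funNorm_le_expIntegralLog (hCs : C.IsSymmetric) (hDs : ∀ τ, (D τ).IsSymmetric)
    (hCpos : ∀ i, 0 < C.tEigenvalues i) (hae : ∀ᵐ τ ∂ν, ∀ i, 0 < (D τ).tEigenvalues i)
    (hW : ∀ i, Integrable (fun τ => Real.log ((D τ).tEigenvalues i)) ν)
    (hle : ∀ k ≤ m * p, ∑ i with i.val < k, Real.log (C.tEigenvalues i) ≤
      ∑ i with i.val < k, ∫ τ, Real.log ((D τ).tEigenvalues i) ∂ν)
    (htot : ∑ i, Real.log (C.tEigenvalues i) = ∑ i, ∫ τ, Real.log ((D τ).tEigenvalues i) ∂ν)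
    {ρ : (Fin (m * p) → ℝ) → ℝ} (hρ : IsSymmetricGauge ρ) {f : ℝ → ℝ} (hf : IsLogConvexExp f) :
    funNorm ρ f C ≤ expIntegralLog ν fun τ => funNorm ρ f (D τ) := by
  have hanti : Antitone fun i => Real.log (C.tEigenvalues i) := fun i j hij =>
    Real.log_le_log (hCpos j) (antitone_tEigenvalues hCs hij)
  rw [funNorm_of_pos_exp_log hρ f hCs hCpos]
  -- A zero vector, which includes the case mp = 0, is split off so that log ρ is meaningful below.
  by_cases hzero : (fun i => f (Real.exp (Real.log (C.tEigenvalues i)))) = 0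
  · rw [hzero, hρ.map_zero, ENNReal.ofReal_zero]
    exact zero_le
  obtain ⟨i₀, hi₀⟩ := Function.ne_iff.1 hzero
  have : NeZero (m * p) := ⟨i₀.pos.ne'⟩
  obtain h0 | ⟨hfpos, hconv⟩ := hf.eq_zero_or_convexOn
  · exact absurd (h0 _) hi₀
  have hΦ := hρ.convexOn_log_comp_exp hconv
  simp only [Real.exp_log (hfpos _)] at hΦ
  have hρpos : ∀ u : Fin (m * p) → ℝ, 0 < ρ fun i => f (Real.exp (u i)) := fun u =>
    hρ.pos fun h => (hfpos (u 0)).ne' (congrFun h 0)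
  obtain ⟨ℓ, hℓ, hℓle, hℓint⟩ := hΦ.exists_integrable_minorant hW
  have hmaj := hΦ.le_of_majorized
    (fun σ u => congrArg Real.log (hρ.perm σ fun i => f (Real.exp (u i)))) hanti hle htot
  rw [← hℓint, Real.log_le_iff_le_exp (hρpos _)] at hmaj
  calc ENNReal.ofReal (ρ fun i => f (Real.exp (Real.log (C.tEigenvalues i))))
      ≤ ENNReal.ofReal (Real.exp (∫ τ, ℓ τ ∂ν)) := ENNReal.ofReal_le_ofReal hmaj
    _ = expIntegralLog ν fun τ => ENNReal.ofReal (Real.exp (ℓ τ)) :=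
        (expIntegralLog_ofReal_exp hℓ).symm
    _ ≤ _ := expIntegralLog_mono_ae (hae.mono fun τ hτ => by
        rw [funNorm_of_pos_exp_log hρ f (hDs τ) hτ]
        exact ENNReal.ofReal_le_ofReal ((Real.le_log_iff_exp_le (hρpos _)).1 (hℓle τ)))

theorem TTensor.funNorm_le_lintegral (hCs : C.IsSymmetric) (hDs : ∀ τ, (D τ).IsSymmetric)
    (hCpos : ∀ i, 0 < C.tEigenvalues i) (hae : ∀ᵐ τ ∂ν, ∀ i, 0 < (D τ).tEigenvalues i)
    (hW : ∀ i, Integrable (fun τ => Real.log ((D τ).tEigenvalues i)) ν)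
    (hle : ∀ k ≤ m * p, ∑ i with i.val < k, Real.log (C.tEigenvalues i) ≤
      ∑ i with i.val < k, ∫ τ, Real.log ((D τ).tEigenvalues i) ∂ν)
    (htot : ∑ i, Real.log (C.tEigenvalues i) = ∑ i, ∫ τ, Real.log ((D τ).tEigenvalues i) ∂ν)
    {ρ : (Fin (m * p) → ℝ) → ℝ} (hρ : IsSymmetricGauge ρ) {g : ℝ → ℝ} (hg : IsConvexExp g) :
    funNorm ρ g C ≤ ∫⁻ τ, funNorm ρ g (D τ) ∂ν := by
  have hanti : Antitone fun i => Real.log (C.tEigenvalues i) := fun i j hij =>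
    Real.log_le_log (hCpos j) (antitone_tEigenvalues hCs hij)
  have hΦ := hρ.convexOn_comp hg.convex fun t => hg.nonneg _ (Real.exp_pos t)
  obtain ⟨ℓ, hℓ, hℓle, hℓint⟩ := hΦ.exists_integrable_minorant hW
  have hmaj := hΦ.le_of_majorized
    (fun σ u => hρ.perm σ fun i => g (Real.exp (u i))) hanti hle htot
  rw [← hℓint] at hmaj
  rw [funNorm_of_pos_exp_log hρ g hCs hCpos]
  refine (ENNReal.ofReal_le_ofReal hmaj).trans
    ((ofReal_integral_le_lintegral_ofReal hℓ).trans (lintegral_mono_ae ?_))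
  filter_upwards [hae] with τ hτ
  rw [funNorm_of_pos_exp_log hρ g (hDs τ) hτ]
  exact ENNReal.ofReal_le_ofReal (hℓle τ)

end

theorem mainTheorem5 {m p : ℕ} [NeZero p]
    {Ω : Type*} [MetricSpace Ω] [SigmaCompactSpace Ω] [MeasurableSpace Ω] [BorelSpace Ω]
    (ν : Measure Ω) [IsProbabilityMeasure ν]
    (C : TTensor m m p) (D : Ω → TTensor m m p)
    (hC : C.IsTPSD) (hD : ∀ τ, (D τ).IsTPSD)
    (hDcont : Continuous D)
    (hDbdd : BddAbove (Set.range fun τ => (D τ).opNorm))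
    (ρ₀ : (Fin (m * p) → ℝ) → ℝ) (hρ₀ : IsSymmetricGauge ρ₀)
    (s : ℝ) (hs : 0 < s)
    (hint : ∫⁻ τ, TTensor.funNorm ρ₀ (fun x => x ^ (-s)) (D τ) ∂ν < ∞) :
    List.TFAE [
      LogMajorized (fun i => ENNReal.ofReal (C.tEigenvalues i))
        (fun i => expIntegralLog ν fun τ => ENNReal.ofReal ((D τ).tEigenvalues i)),
      ∀ ρ : (Fin (m * p) → ℝ) → ℝ, IsSymmetricGauge ρ → ∀ f : ℝ → ℝ, IsLogConvexExp f →
        TTensor.funNorm ρ f C ≤ expIntegralLog ν fun τ => TTensor.funNorm ρ f (D τ),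
      ∀ ρ : (Fin (m * p) → ℝ) → ℝ, IsSymmetricGauge ρ → ∀ g : ℝ → ℝ, IsConvexExp g →
        TTensor.funNorm ρ g C ≤ ∫⁻ τ, TTensor.funNorm ρ g (D τ) ∂ν] := by
  have hDs : ∀ τ, (D τ).IsSymmetric := fun τ => (hD τ).1
  have hmeas := TTensor.measurable_tEigenvalues hD hDcont
  have hD0 : ∀ τ i, 0 ≤ (D τ).tEigenvalues i := fun τ => (TTensor.isTPSD_iff (hDs τ)).1 (hD τ)
  obtain ⟨M, hM⟩ := hDbdd
  have hDM : ∀ i τ, (D τ).tEigenvalues i ≤ M := fun i τ =>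
    (le_abs_self _).trans ((TTensor.abs_tEigenvalues_le_opNorm (hDs τ) i).trans (hM ⟨τ, rfl⟩))
  have hmom := ae_pos_and_integrable_rpow hmeas hρ₀ hD0
    (fun τ hτ => TTensor.funNorm_of_pos hρ₀ _ (hDs τ) hτ)
    (fun τ hτ => TTensor.funNorm_rpow_of_not_pos ρ₀ (neg_neg_iff_pos.2 hs) (hDs τ) hτ) hint
  have hae : ∀ᵐ τ ∂ν, ∀ i, 0 < (D τ).tEigenvalues i := ae_all_iff.2 fun i => (hmom i).1
  have hWm : ∀ i, Measurable fun τ => Real.log ((D τ).tEigenvalues i) := fun i => (hmeas i).log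
  have hexp : ∀ i, Integrable (fun τ => Real.exp (s * |Real.log ((D τ).tEigenvalues i)|)) ν :=
    fun i => integrable_exp_abs_log hs (hmeas i) (hmom i).1 (hDM i) (hmom i).2
  have hW : ∀ i, Integrable (fun τ => Real.log ((D τ).tEigenvalues i)) ν := fun i =>
    integrable_of_integrable_exp_abs hs (hWm i) (hexp i)
  have hmaj_iff := logMajorized_ofReal_iff
    (L := fun i => ∫ τ, Real.log ((D τ).tEigenvalues i) ∂ν) ((TTensor.isTPSD_iff hC.1).1 hC)
  simp only [← expIntegralLog_ofReal_exp (hW _)] at hmaj_iff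
  rw [show (fun i => expIntegralLog ν fun τ =>
      ENNReal.ofReal (Real.exp (Real.log ((D τ).tEigenvalues i)))) =
      fun i => expIntegralLog ν fun τ => ENNReal.ofReal ((D τ).tEigenvalues i) from
    funext fun i => expIntegralLog_congr_ae ((hmom i).1.mono fun τ hτ => by
      rw [Real.exp_log hτ])] at hmaj_iff
  have hSint : ∀ k q, |q| ≤ s / 2 → Integrable (fun τ => ∑ i : Fin (m * p) with i.val < k,
      Real.exp (q * Real.log ((D τ).tEigenvalues i))) ν := fun k q hq =>
    integrable_finsetSum _ fun i _ =>
      integrable_exp_mul_of_abs_le (hWm i) (hexp i) (hq.trans (by linarith))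
  have hS : ∀ k, 1 ≤ k → ∀ q : ℝ, (0 ≤ q ∨ k = m * p) →
      ∀ᵐ τ ∂ν, TTensor.funNorm (kyFan k) (fun x => x ^ q) (D τ) = ENNReal.ofReal
        (∑ i with i.val < k, Real.exp (q * Real.log ((D τ).tEigenvalues i))) :=
    fun k hk q hqk => hae.mono fun τ hτ => TTensor.funNorm_kyFan_rpow hk hqk (hDs τ) hτ
  tfae_have 1 → 2 := fun h ρ hρ f hf => by
    obtain ⟨hCpos, hle, htot⟩ := hmaj_iff.1 h
    exact TTensor.funNorm_le_expIntegralLog hC.1 hDs hCpos hae hW hle htot hρ hf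
  tfae_have 1 → 3 := fun h ρ hρ g hg => by
    obtain ⟨hCpos, hle, htot⟩ := hmaj_iff.1 h
    exact TTensor.funNorm_le_lintegral hC.1 hDs hCpos hae hW hle htot hρ hg
  tfae_have 2 → 1 := fun h => by
    refine hmaj_iff.2 (TTensor.majorized_of_funNorm_rpow_le hC hs hWm hexp ?_)
    intro k hk hkn q hq hqk
    refine (h _ (kyFan_isSymmetricGauge hk) _ (isLogConvexExp_rpow q)).trans ?_
    rw [expIntegralLog_congr_ae (hS k hk q hqk)]
    -- Passing from the geometric to the arithmetic mean leaves the same power inequality that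
    -- statement 3 gives directly.
    refine expIntegralLog_ofReal_le (hSint k q hq) fun τ => ?_
    exact Finset.sum_pos (fun i _ => Real.exp_pos _)
      ⟨⟨0, hk.trans hkn⟩, Finset.mem_filter.2 ⟨Finset.mem_univ _, hk⟩⟩
  tfae_have 3 → 1 := fun h => by
    refine hmaj_iff.2 (TTensor.majorized_of_funNorm_rpow_le hC hs hWm hexp ?_)
    intro k hk hkn q hq hqk
    refine (h _ (kyFan_isSymmetricGauge hk) _ (isConvexExp_rpow q)).trans ?_
    rw [lintegral_congr_ae (hS k hk q hqk), ofReal_integral_eq_lintegral_ofReal (hSint k q hq)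
      (Eventually.of_forall fun τ => Finset.sum_nonneg fun i _ => (Real.exp_pos _).le)]
  tfae_finish
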